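/- Let $S^2\subset\mathbb R^3$ be the unit sphere with its round metric $g_{+1}$ and Laplacian $\Delta$, and fix an integer $m\ge 4$ and $\alpha\in(0,1)$. Let $C^{k,\alpha}$ denote the Hölder space $C^{k,\alpha}(S^2)$ of real functions with its usual norm, and let $$\pi: C^{m,\alpha}\to C^{m-2,\alpha},\qquad \pi(u)=\text{the Gauss curvature of the metric } e^{2u}g_{+1}.$$ Let $C_+^{m-2,\alpha}$ be the set of $K\in C^{m-2,\alpha}$ that are positive somewhere, let $\mathcal C$ be the set of $K\in C_+^{m-2,\alpha}$ having no local maximum at a point where $K=0$, let $\mathcal N$ be the set of $K\in C_+^{m-2,\alpha}$ such that $|\nabla K|(p)+|\Delta K|(p)>0$ whenever $K(p)>0$, and let $\mathcal K=\mathcal C\cap\mathcal N$. For a path component $\mathcal K^i$ of $\mathcal K$, the degree of $\pi:\pi^{-1}(\mathcal K^i)\to\mathcal K^i$ is the sum $\sum_{u\in\pi^{-1}(y)}\operatorname{sign}(D_u\pi)$ at a regular value $y\in\mathcal K^i$ of $\pi$ with finite fibre, where the sign is $\pm1$ according to whether $D_u\pi$ preserves or reverses orientation, with respect to an orientation of the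 index $0$ Fredholm map $\pi$ (a continuous choice of orientation of its derivatives). Degree zero below means degree zero with respect to every orientation of $\pi$. For $a\in\mathbb R^3$ let $\ell_a(x)=\langle a,x\rangle$, $x\in S^2$. **Proposition 4.4.** (i) For every $K\in C^{m-2,\alpha}$, the set $\{a\in\mathbb R^3: K+\ell_a\in \operatorname{Im}\pi\}$ is bounded in $\mathbb R^3$. (ii) There is a path component $\mathcal K^0$ of $\mathcal K$ of degree zero such that for every $K\in C^{m-2,\alpha}$ there is $R=R(K)$ such that for all $a\in\mathbb R^3$ with $|a|>R$ one has $K+\ell_a\in\mathcal K^0$, and the equation $$e^{2u}(K+\ell_a)=1-\Delta u\quad\text{on } S^2$$ has no solution $u\in C^{m,\alpha}$. -/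

import Mathlib

noncomputable section

namespace Nirenberg

/-- Euclidean three-space. -/
abbrev E3 : Type := EuclideanSpace ℝ (Fin 3)

/-- The round unit sphere `S²` in `ℝ³`. -/
abbrev S2 : Type := Metric.sphere (0 : E3) 1

/-- The extension of `f : S² → ℝ` to `ℝ³ ∖ {0}` that is homogeneous of degree `0`,
`x ↦ f (x / |x|)` (with value `0` at the origin). -/
def radialExt (f : S2 → ℝ) (x : E3) : ℝ :=
  if h : x = 0 then 0 else f ⟨‖x‖⁻¹ • x, by
    rw [mem_sphere_zero_iff_norm, norm_smul, norm_inv, norm_norm,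
      inv_mul_cancel₀ (norm_ne_zero_iff.mpr h)]⟩

/-- `F` is of class `C^k` off the origin, and its `k`-th derivative is `α`-Hölder along the unit
sphere. -/
def HolderReg {V : Type} [NormedAddCommGroup V] [NormedSpace ℝ V] (k : ℕ) (α : ℝ)
    (F : E3 → V) : Prop :=
  ContDiffOn ℝ k F {0}ᶜ ∧
    ∃ C : ℝ, ∀ x y : S2,
      ‖iteratedFDeriv ℝ k F x - iteratedFDeriv ℝ k F y‖ ≤ C * ‖(x : E3) - y‖ ^ α

section reg

variable {V W Z : Type} [NormedAddCommGroup V] [NormedSpace ℝ V] [NormedAddCommGroup W]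
  [NormedSpace ℝ W] [NormedAddCommGroup Z] [NormedSpace ℝ Z] {k : ℕ} {α : ℝ}

theorem isOpen_punct : IsOpen ({0}ᶜ : Set E3) := isOpen_compl_singleton

theorem S2.ne_zero (x : S2) : (x : E3) ≠ 0 := by
  intro h
  have := mem_sphere_zero_iff_norm.mp x.2
  simp [h] at this

theorem S2.mem (x : S2) : (x : E3) ∈ ({0}ᶜ : Set E3) := S2.ne_zero x

theorem S2.norm_sub_le (x y : S2) : ‖(x : E3) - y‖ ≤ 2 := by
  have hx := mem_sphere_zero_iff_norm.mp x.2
  have hy := mem_sphere_zero_iff_norm.mp y.2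
  linarith [_root_.norm_sub_le (x : E3) (y : E3)]

theorem eventuallyEq_of_eqOn {V : Type} {F G : E3 → V} (h : Set.EqOn F G {0}ᶜ) {x : E3} (hx : x ≠ 0) :
    F =ᶠ[nhds x] G :=
  Filter.eventuallyEq_of_mem (isOpen_punct.mem_nhds hx) h

theorem HolderReg.congr {F G : E3 → V} (hF : HolderReg k α F) (h : Set.EqOn G F {0}ᶜ) :
    HolderReg k α G := by
  refine ⟨hF.1.congr h, ?_⟩
  obtain ⟨C, hC⟩ := hF.2
  refine ⟨C, fun x y => ?_⟩
  rw [((eventuallyEq_of_eqOn h (S2.ne_zero x)).iteratedFDeriv ℝ k).eq_of_nhds,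
    ((eventuallyEq_of_eqOn h (S2.ne_zero y)).iteratedFDeriv ℝ k).eq_of_nhds]
  exact hC x y

theorem HolderReg.contDiffAt {F : E3 → V} (hF : HolderReg k α F) {x : E3} (hx : x ≠ 0) :
    ContDiffAt ℝ k F x := hF.1.contDiffAt (isOpen_punct.mem_nhds hx)

theorem HolderReg.add {F G : E3 → V} (hF : HolderReg k α F) (hG : HolderReg k α G) :
    HolderReg k α (F + G) := by
  refine ⟨hF.1.add hG.1, ?_⟩
  obtain ⟨C, hC⟩ := hF.2
  obtain ⟨D, hD⟩ := hG.2
  refine ⟨C + D, fun x y => ?_⟩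
  rw [iteratedFDeriv_add_apply (hF.contDiffAt (S2.ne_zero x)) (hG.contDiffAt (S2.ne_zero x)),
    iteratedFDeriv_add_apply (hF.contDiffAt (S2.ne_zero y)) (hG.contDiffAt (S2.ne_zero y)),
    add_sub_add_comm, add_mul]
  exact (norm_add_le _ _).trans (add_le_add (hC x y) (hD x y))

theorem HolderReg.const_smul {F : E3 → V} (c : ℝ) (hF : HolderReg k α F) :
    HolderReg k α (c • F) := by
  refine ⟨contDiffOn_const.smul hF.1, ?_⟩
  obtain ⟨C, hC⟩ := hF.2
  refine ⟨|c| * C, fun x y => ?_⟩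
  rw [iteratedFDeriv_const_smul_apply (hF.contDiffAt (S2.ne_zero x)),
    iteratedFDeriv_const_smul_apply (hF.contDiffAt (S2.ne_zero y)), ← smul_sub, norm_smul,
    Real.norm_eq_abs, mul_assoc]
  exact mul_le_mul_of_nonneg_left (hC x y) (abs_nonneg c)

theorem exists_holder_of_contDiffOn_one (hα : α ∈ Set.Ioo (0 : ℝ) 1) {F : E3 → V}
    (hF : ContDiffOn ℝ 1 F {0}ᶜ) :
    ∃ C : ℝ, ∀ x y : S2, ‖F x - F y‖ ≤ C * ‖(x : E3) - y‖ ^ α := by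
  have hloc : LocallyLipschitzOn (Metric.sphere (0 : E3) 1) F := by
    intro x hx
    have hx0 : x ≠ 0 := S2.ne_zero ⟨x, hx⟩
    obtain ⟨K, t, ht, hK⟩ :=
      (hF.contDiffAt (isOpen_punct.mem_nhds hx0)).exists_lipschitzOnWith
    exact ⟨K, t, mem_nhdsWithin_of_mem_nhds ht, hK⟩
  obtain ⟨K, hK⟩ := hloc.exists_lipschitzOnWith_of_compact (isCompact_sphere _ _)
  refine ⟨K * 2, fun x y => ?_⟩
  have h1 := hK.norm_sub_le x.2 y.2
  refine h1.trans ?_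
  rw [mul_assoc]
  refine mul_le_mul_of_nonneg_left ?_ K.2
  have h0 : 0 ≤ ‖(x : E3) - y‖ := norm_nonneg _
  have h2 := S2.norm_sub_le x y
  rcases h0.eq_or_lt with h | h
  · rw [← h]; positivity
  · calc ‖(x : E3) - y‖ = ‖(x : E3) - y‖ ^ (1 - α) * ‖(x : E3) - y‖ ^ α := by
          rw [← Real.rpow_add h]; simp
      _ ≤ 2 * ‖(x : E3) - y‖ ^ α := by
          gcongr
          calc ‖(x : E3) - y‖ ^ (1 - α) ≤ 2 ^ (1 - α) :=
                Real.rpow_le_rpow h0 h2 (by linarith [hα.2])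
            _ ≤ 2 ^ (1 : ℝ) := Real.rpow_le_rpow_of_exponent_le (by norm_num) (by linarith [hα.1])
            _ = 2 := by simp

theorem contDiffOn_iteratedFDeriv {F : E3 → V} {j n : ℕ} (hF : ContDiffOn ℝ ((n + j : ℕ)) F {0}ᶜ) :
    ContDiffOn ℝ n (iteratedFDeriv ℝ j F) {0}ᶜ := by
  intro x hx
  have := (hF.contDiffAt (isOpen_punct.mem_nhds hx)).iteratedFDeriv_right (i := j) (m := n)
    (by push_cast; exact le_rfl)
  exact this.contDiffWithinAt

theorem HolderReg.of_contDiffOn (hα : α ∈ Set.Ioo (0 : ℝ) 1) {F : E3 → V}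
    (hF : ContDiffOn ℝ ((k + 1 : ℕ)) F {0}ᶜ) : HolderReg k α F := by
  refine ⟨hF.of_le (by exact_mod_cast Nat.le_succ k), ?_⟩
  apply exists_holder_of_contDiffOn_one hα
  exact_mod_cast contDiffOn_iteratedFDeriv (n := 1) (j := k) (by rwa [add_comm])

theorem HolderReg.of_succ (hα : α ∈ Set.Ioo (0 : ℝ) 1) {F : E3 → V}
    (hF : HolderReg (k + 1) α F) : HolderReg k α F := HolderReg.of_contDiffOn hα hF.1

theorem norm_iteratedFDeriv_succ_sub (F : E3 → V) (x y : E3) :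
    ‖iteratedFDeriv ℝ (k + 1) F x - iteratedFDeriv ℝ (k + 1) F y‖ =
      ‖iteratedFDeriv ℝ k (fderiv ℝ F) x - iteratedFDeriv ℝ k (fderiv ℝ F) y‖ := by
  have h : ∀ z, iteratedFDeriv ℝ (k + 1) F z =
      (continuousMultilinearCurryRightEquiv' ℝ k E3 V).symm (iteratedFDeriv ℝ k (fderiv ℝ F) z) :=
    fun z => by rw [iteratedFDeriv_succ_eq_comp_right]; rfl
  rw [h, h]
  exact (congrArg norm (LinearIsometryEquiv.map_sub
    (continuousMultilinearCurryRightEquiv' ℝ k E3 V).symm _ _).symm).trans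
      (LinearIsometryEquiv.norm_map _ _)

theorem HolderReg.fderiv {F : E3 → V} (hF : HolderReg (k + 1) α F) :
    HolderReg k α (fderiv ℝ F) := by
  refine ⟨?_, ?_⟩
  · exact hF.1.fderiv_of_isOpen isOpen_punct (by push_cast; exact le_rfl)
  · obtain ⟨C, hC⟩ := hF.2
    exact ⟨C, fun x y => by rw [← norm_iteratedFDeriv_succ_sub]; exact hC x y⟩

theorem HolderReg.succ {F : E3 → V} (h0 : DifferentiableOn ℝ F {0}ᶜ)
    (hF : HolderReg k α (_root_.fderiv ℝ F)) : HolderReg (k + 1) α F := by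
  refine ⟨?_, ?_⟩
  · push_cast
    rw [contDiffOn_succ_iff_fderiv_of_isOpen isOpen_punct]
    exact ⟨h0, by simp, hF.1⟩
  · obtain ⟨C, hC⟩ := hF.2
    exact ⟨C, fun x y => by rw [norm_iteratedFDeriv_succ_sub]; exact hC x y⟩

theorem HolderReg.differentiableAt {F : E3 → V} (hF : HolderReg (k + 1) α F) {x : E3}
    (hx : x ≠ 0) : DifferentiableAt ℝ F x :=
  (hF.contDiffAt hx).differentiableAt (by simp)

theorem exists_bound {F : E3 → V} (hF : ContDiffOn ℝ k F {0}ᶜ) :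
    ∃ C : ℝ, 0 ≤ C ∧ ∀ x : S2, ‖F x‖ ≤ C := by
  have hc : ContinuousOn F (Metric.sphere (0 : E3) 1) :=
    hF.continuousOn.mono (fun x hx => S2.ne_zero ⟨x, hx⟩)
  obtain ⟨C, hC⟩ := (isCompact_sphere (0 : E3) 1).exists_bound_of_continuousOn hc
  exact ⟨max C 0, le_max_right _ _, fun x => (hC x x.2).trans (le_max_left _ _)⟩

theorem holderReg_zero_iff {F : E3 → V} : HolderReg 0 α F ↔ ContDiffOn ℝ 0 F {0}ᶜ ∧
    ∃ C : ℝ, ∀ x y : S2, ‖F x - F y‖ ≤ C * ‖(x : E3) - y‖ ^ α := by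
  unfold HolderReg
  simp only [iteratedFDeriv_zero_eq_comp, Function.comp_apply, ← map_sub,
    LinearIsometryEquiv.norm_map, Nat.cast_zero]

theorem HolderReg.bilin (hα : α ∈ Set.Ioo (0 : ℝ) 1) (B : V →L[ℝ] W →L[ℝ] Z) {F : E3 → V}
    {G : E3 → W} (hF : HolderReg k α F) (hG : HolderReg k α G) :
    HolderReg k α (fun x => B (F x) (G x)) := by
  induction k generalizing V W Z with
  | zero =>
    obtain ⟨CF, hCF0, hCF⟩ := exists_bound hF.1
    obtain ⟨CG, hCG0, hCG⟩ := exists_bound hG.1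
    rw [holderReg_zero_iff] at hF hG ⊢
    obtain ⟨hF, C, hC⟩ := hF
    obtain ⟨hG, D, hD⟩ := hG
    refine ⟨B.isBoundedBilinearMap.contDiff.comp_contDiffOn (hF.prodMk hG),
      ‖B‖ * (CF * D + C * CG), fun x y => ?_⟩
    have e : B (F x) (G x) - B (F y) (G y) = B (F x) (G x - G y) + B (F x - F y) (G y) := by
      simp
    rw [e]
    calc _ ≤ ‖B (F x) (G x - G y)‖ + ‖B (F x - F y) (G y)‖ := norm_add_le _ _
      _ ≤ ‖B‖ * CF * (D * ‖(x : E3) - y‖ ^ α) + ‖B‖ * (C * ‖(x : E3) - y‖ ^ α) * CG := by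
        refine add_le_add ((B.le_opNorm₂ _ _).trans ?_) ((B.le_opNorm₂ _ _).trans ?_)
        · gcongr
          exacts [hCF x, hD x y]
        · gcongr
          · exact mul_nonneg (by positivity) ((norm_nonneg _).trans (hC x y))
          · exact hC x y
          · exact hCG y
      _ = _ := by ring
  | succ k ih =>
    have hd : ∀ x : E3, x ≠ 0 → HasFDerivAt (fun x => B (F x) (G x))
        (B.precompR E3 (F x) (_root_.fderiv ℝ G x) + B.precompL E3 (_root_.fderiv ℝ F x) (G x)) x :=
      fun x hx => B.hasFDerivAt_of_bilinear (hF.differentiableAt hx).hasFDerivAt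
        (hG.differentiableAt hx).hasFDerivAt
    refine HolderReg.succ (fun x hx => (hd x hx).differentiableAt.differentiableWithinAt) ?_
    refine HolderReg.congr (F := (fun x => B.precompR E3 (F x) (_root_.fderiv ℝ G x)) +
      fun x => B.precompL E3 (_root_.fderiv ℝ F x) (G x)) ?_ (fun x hx => (hd x hx).fderiv)
    exact (ih (B.precompR E3) (hF.of_succ hα) hG.fderiv).add
      (ih (B.precompL E3) hF.fderiv (hG.of_succ hα))

theorem HolderReg.clm_comp (hα : α ∈ Set.Ioo (0 : ℝ) 1) (L : V →L[ℝ] W) {F : E3 → V}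
    (hF : HolderReg k α F) : HolderReg k α (fun x => L (F x)) := by
  have h1 : HolderReg k α (fun _ : E3 => (1 : ℝ)) := HolderReg.of_contDiffOn hα contDiffOn_const
  simpa using HolderReg.bilin hα (ContinuousLinearMap.toSpanSingleton ℝ L) h1 hF

theorem HolderReg.mul (hα : α ∈ Set.Ioo (0 : ℝ) 1) {F G : E3 → ℝ}
    (hF : HolderReg k α F) (hG : HolderReg k α G) : HolderReg k α (fun x => F x * G x) :=
  HolderReg.bilin hα (ContinuousLinearMap.mul ℝ ℝ) hF hG

theorem HolderReg.exp (hα : α ∈ Set.Ioo (0 : ℝ) 1) {F : E3 → ℝ}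
    (hF : HolderReg (k + 1) α F) : HolderReg k α (fun x => Real.exp (F x)) :=
  HolderReg.of_contDiffOn hα hF.1.exp

end reg

/-- The Laplace–Beltrami operator of the round sphere: the Euclidean Laplacian of the extension
that is homogeneous of degree `0`. -/
def sphereLaplacian (f : S2 → ℝ) (x : S2) : ℝ := Laplacian.laplacian (radialExt f) (x : E3)

/-- The gradient of `f` on the round sphere: the Euclidean gradient of the extension that is
homogeneous of degree `0` (it is tangent to the sphere). -/
def sphereGradient (f : S2 → ℝ) (x : S2) : E3 := gradient (radialExt f) (x : E3)

/-- The Gauss curvature at `y` of the metric `lam |dy|²` on a Euclidean plane, in the isothermal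
coordinates `y`: `- Δ (log lam) / (2 lam)`. -/
def isothermalCurvature {P : Type} [NormedAddCommGroup P] [InnerProductSpace ℝ P]
    [FiniteDimensional ℝ P] (lam : P → ℝ) (y : P) : ℝ :=
  -(Laplacian.laplacian (fun z => Real.log (lam z)) y) / (2 * lam y)

theorem norm_neg_coe (x : S2) : ‖(-(x : E3))‖ = 1 := by
  rw [norm_neg]; exact mem_sphere_zero_iff_norm.mp x.2

/-- The metric `e^{2u} g` (`g` the round metric) in the stereographic chart with pole `-x`, which is
centred at `x`: stereographic projection pulls `g` back to `(4 / (|y|² + 4))² |dy|²`. -/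
def chartFactor (u : S2 → ℝ) (x : S2) (y : (ℝ ∙ (-(x : E3)))ᗮ) : ℝ :=
  Real.exp (2 * u (stereoInvFun (norm_neg_coe x) y)) * (4 / (‖y‖ ^ 2 + 4)) ^ 2

/-- The Gauss curvature at `x` of the metric `e^{2u} g` on `S²`, computed in the stereographic chart
centred at `x`. -/
def gaussCurvature (u : S2 → ℝ) (x : S2) : ℝ := isothermalCurvature (chartFactor u x) 0

section curvature

theorem radialExt_of_ne (f : S2 → ℝ) {x : E3} (h : x ≠ 0) : radialExt f x = f ⟨‖x‖⁻¹ • x, by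
    rw [mem_sphere_zero_iff_norm, norm_smul, norm_inv, norm_norm,
      inv_mul_cancel₀ (norm_ne_zero_iff.mpr h)]⟩ := dif_neg h

theorem radialExt_coe (f : S2 → ℝ) (x : S2) : radialExt f x = f x := by
  rw [radialExt_of_ne f (S2.ne_zero x)]
  congr 1
  apply Subtype.ext
  simp [mem_sphere_zero_iff_norm.mp x.2]

theorem radialExt_smul (f : S2 → ℝ) {c : ℝ} (hc : 0 < c) (x : E3) :
    radialExt f (c • x) = radialExt f x := by
  by_cases h : x = 0
  · simp [h]
  · rw [radialExt_of_ne f h, radialExt_of_ne f (smul_ne_zero hc.ne' h)]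
    congr 1
    apply Subtype.ext
    simp only [norm_smul, Real.norm_eq_abs, abs_of_pos hc, smul_smul]
    congr 1
    field_simp

theorem iteratedFDeriv_two_diag {E : Type} [NormedAddCommGroup E] [NormedSpace ℝ E] (f : E → ℝ)
    (x w : E) : iteratedFDeriv ℝ 2 f x ![w, w] = fderiv ℝ (fderiv ℝ f) x w w := by
  rw [iteratedFDeriv_two_apply]; rfl

theorem laplacian_eq_sum {E : Type} [NormedAddCommGroup E] [InnerProductSpace ℝ E]
    [FiniteDimensional ℝ E] {ι : Type} [Fintype ι] (b : OrthonormalBasis ι ℝ E) (f : E → ℝ)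
    (x : E) : Laplacian.laplacian f x = ∑ i, fderiv ℝ (fderiv ℝ f) x (b i) (b i) := by
  rw [InnerProductSpace.laplacian_eq_iteratedFDeriv_orthonormalBasis f b]
  simp only [iteratedFDeriv_two_diag]

theorem radialExt_fderiv_smul (f : S2 → ℝ) {c : ℝ} (hc : 0 < c) (x : E3) :
    c • fderiv ℝ (radialExt f) (c • x) = fderiv ℝ (radialExt f) x := by
  rw [← fderiv_comp_smul]
  congr 1
  exact funext (radialExt_smul f hc)

theorem radialExt_fderiv_fderiv_smul (f : S2 → ℝ) {c : ℝ} (hc : 0 < c) (x : E3) :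
    c ^ 2 • fderiv ℝ (fderiv ℝ (radialExt f)) (c • x) = fderiv ℝ (fderiv ℝ (radialExt f)) x := by
  have h : fderiv ℝ (radialExt f) = c • fun x => fderiv ℝ (radialExt f) (c • x) :=
    funext fun x => (radialExt_fderiv_smul f hc x).symm
  conv_rhs => rw [h]
  have h' := congrFun (fderiv_const_smul_field (𝕜 := ℝ)
    (f := fun x => fderiv ℝ (radialExt f) (c • x)) c) x
  rw [h', Pi.smul_apply, fderiv_comp_smul (f := fderiv ℝ (radialExt f)),
    smul_smul, sq]

theorem radialExt_laplacian_smul (f : S2 → ℝ) {c : ℝ} (hc : 0 < c) (x : E3) :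
    c ^ 2 * Laplacian.laplacian (radialExt f) (c • x) = Laplacian.laplacian (radialExt f) x := by
  rw [laplacian_eq_sum (EuclideanSpace.basisFun (Fin 3) ℝ),
    laplacian_eq_sum (EuclideanSpace.basisFun (Fin 3) ℝ), Finset.mul_sum]
  refine Finset.sum_congr rfl fun i _ => ?_
  rw [← radialExt_fderiv_fderiv_smul f hc x]
  rfl

/-- The Hessian of the homogeneous extension vanishes in the radial direction. -/
theorem radialExt_hess_radial (f : S2 → ℝ) {x : E3}
    (hf : ContDiffAt ℝ 2 (radialExt f) x) :
    fderiv ℝ (fderiv ℝ (radialExt f)) x x x = 0 := by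
  have hr : ∀ y : E3, DifferentiableAt ℝ (radialExt f) y → fderiv ℝ (radialExt f) y y = 0 := by
    intro y hy
    have h1 : HasDerivAt (fun t : ℝ => t • y) y 1 := by
      simpa using (hasDerivAt_id (1 : ℝ)).smul_const y
    have h2 : HasDerivAt (fun t : ℝ => radialExt f (t • y)) (fderiv ℝ (radialExt f) y y) 1 :=
      HasFDerivAt.comp_hasDerivAt_of_eq (1 : ℝ) hy.hasFDerivAt h1 (one_smul ℝ y).symm
    have h3 : HasDerivAt (fun t : ℝ => radialExt f (t • y)) 0 1 := by
      refine (hasDerivAt_const (1 : ℝ) (radialExt f y)).congr_of_eventuallyEq ?_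
      filter_upwards [lt_mem_nhds (zero_lt_one' ℝ)] with t ht
      exact radialExt_smul f ht y
    exact h2.unique h3
  have hd : ∀ᶠ y in nhds x, DifferentiableAt ℝ (radialExt f) y := by
    have := hf.eventually (by simp)
    filter_upwards [this] with y hy using hy.differentiableAt (by simp)
  have hD : HasFDerivAt (fderiv ℝ (radialExt f)) (fderiv ℝ (fderiv ℝ (radialExt f)) x) x :=
    ((hf.fderiv_right (m := 1) (by norm_num)).differentiableAt (by simp)).hasFDerivAt
  have h4 : HasFDerivAt (fun y => fderiv ℝ (radialExt f) y y) _ x :=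
    hD.clm_apply (hasFDerivAt_id x)
  have h5 : HasFDerivAt (fun y => fderiv ℝ (radialExt f) y y) (0 : E3 →L[ℝ] ℝ) x := by
    refine (hasFDerivAt_const (0 : ℝ) x).congr_of_eventuallyEq ?_
    filter_upwards [hd] with y hy using hr y hy
  have h6 := congrArg (fun L : E3 →L[ℝ] ℝ => L x) (h4.unique h5)
  simpa [hr x hd.self_of_nhds] using h6

theorem finrank_perp (x : S2) : Module.finrank ℝ ((ℝ ∙ (-(x : E3)))ᗮ : Submodule ℝ E3) = 2 := by
  have : Fact (Module.finrank ℝ E3 = 2 + 1) := ⟨by simp⟩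
  exact Submodule.finrank_orthogonal_span_singleton (neg_ne_zero.mpr (S2.ne_zero x))

/-- The Laplacian of the homogeneous extension at `x ∈ S²` is the Laplacian of its restriction to
the tangent plane at `x`. -/
theorem laplacian_radialExt_eq (f : S2 → ℝ) (x : S2) (hf : ContDiffAt ℝ 2 (radialExt f) x)
    (b : OrthonormalBasis (Fin 2) ℝ ((ℝ ∙ (-(x : E3)))ᗮ : Submodule ℝ E3)) :
    Laplacian.laplacian (radialExt f) (x : E3) =
      ∑ i, fderiv ℝ (fderiv ℝ (radialExt f)) x (b i) (b i) := by
  have hxn : ‖(x : E3)‖ = 1 := mem_sphere_zero_iff_norm.mp x.2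
  let v : Fin 3 → E3 := Fin.cons (x : E3) (fun i => (b i : E3))
  have hperp : ∀ i, inner ℝ (x : E3) (b i : E3) = 0 := by
    intro i
    have := Submodule.mem_orthogonal_singleton_iff_inner_right.mp (b i).2
    simpa [inner_neg_left] using this
  have hbb : ∀ i j, inner ℝ (b i : E3) (b j : E3) = if i = j then (1 : ℝ) else 0 :=
    fun i j => (orthonormal_iff_ite.mp b.orthonormal i j)
  have hv : Orthonormal ℝ v := by
    rw [orthonormal_iff_ite]
    intro i j
    refine Fin.cases ?_ (fun i => ?_) i <;> refine Fin.cases ?_ (fun j => ?_) j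
    · simp [v, hxn]
    · simp [v, hperp, (Fin.succ_ne_zero _).symm]
    · simp [v, hperp, Fin.succ_ne_zero, real_inner_comm]
    · simp [v, hbb]
  obtain ⟨c, hc⟩ := Orthonormal.exists_orthonormalBasis_extension_of_card_eq (𝕜 := ℝ)
    (v := v) (s := Set.univ) (by simp) (hv.comp _ Subtype.val_injective)
  rw [laplacian_eq_sum c, Fin.sum_univ_succ]
  simp only [hc _ (Set.mem_univ _)]
  simp [v, radialExt_hess_radial f hf]

/-- Second derivatives are unchanged under a change of variables which is the identity to second
order. -/
theorem fderiv_fderiv_comp {P : Type} [NormedAddCommGroup P] [NormedSpace ℝ P] (f : P → ℝ)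
    (ψ : P → P) (hf : ContDiffAt ℝ 2 f 0) (h0 : ψ 0 = 0)
    (hd : ∀ᶠ y in nhds (0 : P), DifferentiableAt ℝ ψ y)
    (h1 : fderiv ℝ ψ 0 = ContinuousLinearMap.id ℝ P)
    (h2 : HasFDerivAt (fderiv ℝ ψ) (0 : P →L[ℝ] P →L[ℝ] P) 0) :
    HasFDerivAt (fderiv ℝ (fun y => f (ψ y))) (fderiv ℝ (fderiv ℝ f) 0) 0 := by
  have hc : ContinuousAt ψ 0 := hd.self_of_nhds.continuousAt
  have hfd : ∀ᶠ y in nhds (0 : P), DifferentiableAt ℝ f (ψ y) := by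
    have h := hf.eventually (by simp)
    have h' : Filter.Tendsto ψ (nhds 0) (nhds 0) := by simpa [ContinuousAt, h0] using hc
    filter_upwards [h'.eventually h] with y hy using hy.differentiableAt (by simp)
  have he : fderiv ℝ (fun y => f (ψ y)) =ᶠ[nhds 0]
      fun y => (fderiv ℝ f (ψ y)).comp (fderiv ℝ ψ y) := by
    filter_upwards [hfd, hd] with y hy hy'
    exact fderiv_comp y hy hy'
  have hD : HasFDerivAt (fderiv ℝ f) (fderiv ℝ (fderiv ℝ f) 0) (ψ 0) := by
    rw [h0]
    exact ((hf.fderiv_right (m := 1) (by norm_num)).differentiableAt (by simp)).hasFDerivAt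
  have hψ : HasFDerivAt ψ (ContinuousLinearMap.id ℝ P) 0 := h1 ▸ hd.self_of_nhds.hasFDerivAt
  have h3 := (hD.comp (0 : P) hψ).clm_comp h2
  refine HasFDerivAt.congr_of_eventuallyEq ?_ he
  refine h3.congr_fderiv ?_
  ext a c
  simp [h1]

theorem hasFDerivAt_normSq {P : Type} [NormedAddCommGroup P] [InnerProductSpace ℝ P] (y : P) :
    HasFDerivAt (fun z : P => ‖z‖ ^ 2) ((2 : ℝ) • innerSL ℝ y) y := by
  refine (hasStrictFDerivAt_norm_sq y).hasFDerivAt.congr_fderiv ?_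
  ext z
  simp [two_smul]

theorem hasFDerivAt_logFactor {P : Type} [NormedAddCommGroup P] [InnerProductSpace ℝ P] :
    HasFDerivAt (fderiv ℝ (fun y : P => Real.log (4 / (‖y‖ ^ 2 + 4))))
      (-(1 / 2 : ℝ) • innerSL ℝ) (0 : P) := by
  have h1 : fderiv ℝ (fun y : P => Real.log (4 / (‖y‖ ^ 2 + 4))) =
      fun y => (-(2 / (‖y‖ ^ 2 + 4))) • innerSL ℝ y := by
    funext y
    have hy : ‖y‖ ^ 2 + 4 ≠ 0 := by positivity
    have e : (fun y : P => Real.log (4 / (‖y‖ ^ 2 + 4))) =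
        fun y => Real.log 4 - Real.log (‖y‖ ^ 2 + 4) := by
      funext z
      rw [Real.log_div (by norm_num) (by positivity)]
    rw [e]
    have h := (((hasFDerivAt_normSq y).add_const 4).log hy).const_sub (Real.log 4)
    rw [h.fderiv]
    ext z
    simp
    field_simp
  rw [h1]
  have h2 : HasFDerivAt (fun y : P => -(2 / (‖y‖ ^ 2 + 4))) (0 : P →L[ℝ] ℝ) 0 := by
    have h := ((hasDerivAt_inv (x := ‖(0 : P)‖ ^ 2 + 4) (by positivity)).comp_hasFDerivAt (0 : P)
      ((hasFDerivAt_normSq (0 : P)).add_const 4)).const_mul (-2)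
    refine (h.congr_fderiv (by simp)).congr_of_eventuallyEq (Filter.Eventually.of_forall ?_)
    intro y
    simp only [div_eq_mul_inv, Function.comp_apply]
    ring
  have h3 := h2.smul (innerSL ℝ (E := P)).hasFDerivAt
  refine h3.congr_fderiv ?_
  ext a c
  simp
  left
  norm_num

theorem contDiff_normSq_factor {P : Type} [NormedAddCommGroup P] [InnerProductSpace ℝ P] :
    ContDiff ℝ 2 (fun y : P => Real.log (4 / (‖y‖ ^ 2 + 4))) := by
  refine ContDiff.log (contDiff_const.div ((contDiff_norm_sq ℝ).add contDiff_const) ?_) ?_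
  all_goals intro y; positivity

section change

variable {P : Type} [NormedAddCommGroup P] [InnerProductSpace ℝ P]

/-- Auxiliary radial factor: the point `y` of the stereographic chart centred at `x` lies on the ray
through `x + radFactor y • y`. -/
def radFactor (y : P) : ℝ := 4 / (4 - ‖y‖ ^ 2)

/-- Auxiliary change of variables, the identity to second order at `0`. -/
def radChange (y : P) : P := radFactor y • y

theorem eventually_norm_lt {P : Type} [NormedAddCommGroup P] : ∀ᶠ y : P in nhds 0, 0 < 4 - ‖y‖ ^ 2 := by
  have hc : Continuous (fun y : P => 4 - ‖y‖ ^ 2) := by fun_prop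
  exact (hc.tendsto 0).eventually (lt_mem_nhds (by simp))

theorem hasFDerivAt_radFactor (y : P) (hy : 0 < 4 - ‖y‖ ^ 2) :
    HasFDerivAt radFactor ((8 / (4 - ‖y‖ ^ 2) ^ 2) • innerSL ℝ y) y := by
  have h := ((hasDerivAt_inv hy.ne').comp_hasFDerivAt y
    ((hasFDerivAt_normSq y).const_sub 4)).const_mul 4
  refine (h.congr_fderiv ?_).congr_of_eventuallyEq (Filter.Eventually.of_forall ?_)
  · ext z
    simp
    field_simp
    ring
  · intro z
    simp only [radFactor, div_eq_mul_inv, Function.comp_apply]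

theorem hasFDerivAt_radChange (y : P) (hy : 0 < 4 - ‖y‖ ^ 2) : HasFDerivAt radChange
    (radFactor y • ContinuousLinearMap.id ℝ P +
      ((8 / (4 - ‖y‖ ^ 2) ^ 2) • innerSL ℝ y).smulRight y) y :=
  (hasFDerivAt_radFactor y hy).smul (hasFDerivAt_id y)

theorem hasFDerivAt_fderiv_radChange : HasFDerivAt (fderiv ℝ radChange) (0 : P →L[ℝ] P →L[ℝ] P) 0 := by
  have hq0 : HasFDerivAt radFactor (0 : P →L[ℝ] ℝ) 0 := (hasFDerivAt_radFactor 0 (by simp)).congr_fderiv (by simp)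
  have hs : HasFDerivAt (fun y : P => 8 / (4 - ‖y‖ ^ 2) ^ 2) (fderiv ℝ (fun y : P =>
      8 / (4 - ‖y‖ ^ 2) ^ 2) 0) 0 := by
    refine DifferentiableAt.hasFDerivAt (ContDiffAt.differentiableAt (n := 1) ?_ (by simp))
    refine contDiffAt_const.div ((contDiffAt_const.sub (contDiff_norm_sq ℝ).contDiffAt).pow 2) ?_
    simp
  have h1 := hq0.smul_const (ContinuousLinearMap.id ℝ P)
  let B : (P →L[ℝ] ℝ) →L[ℝ] P →L[ℝ] P →L[ℝ] P := ContinuousLinearMap.smulRightL ℝ P P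
  have h2 := B.hasFDerivAt_of_bilinear (hs.fun_smul (innerSL ℝ (E := P)).hasFDerivAt)
    (hasFDerivAt_id (0 : P))
  have h3 := h1.add h2
  have h4 := h3.congr_of_eventuallyEq (f₁ := fderiv ℝ radChange) (by
    filter_upwards [eventually_norm_lt (P := P)] with y hy using (hasFDerivAt_radChange y hy).fderiv)
  refine h4.congr_fderiv ?_
  ext a c
  simp [B]

theorem contDiffAt_radChange : ContDiffAt ℝ 2 (radChange (P := P)) 0 :=
  ContDiffAt.smul (contDiffAt_const.div
    (contDiffAt_const.sub (contDiff_norm_sq ℝ).contDiffAt) (by simp)) contDiffAt_id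

end change

/-- For `g = e^{2u} g₊₁` on the unit sphere, `e^{2u} K = 1 - Δ u`. -/
theorem gaussCurvature_eq (u : S2 → ℝ) (x : S2) (hu : ContDiffAt ℝ 2 (radialExt u) x) :
    gaussCurvature u x = Real.exp (-(2 * u x)) * (1 - sphereLaplacian u x) := by
  let P := ((ℝ ∙ (-(x : E3)))ᗮ : Submodule ℝ E3)
  let b : OrthonormalBasis (Fin 2) ℝ P :=
    (stdOrthonormalBasis ℝ P).reindex (finCongr (finrank_perp x))
  -- the function `y ↦ u (x + y)` on the tangent plane and the change of variables
  let A : P → ℝ := fun y => radialExt u ((x : E3) + y)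
  have hA1 : ∀ y : P, DifferentiableAt ℝ (radialExt u) ((x : E3) + y) →
      fderiv ℝ A y = (fderiv ℝ (radialExt u) ((x : E3) + y)).comp P.subtypeL := by
    intro y hy
    have h : HasFDerivAt (fun y : P => (x : E3) + y) P.subtypeL y :=
      P.subtypeL.hasFDerivAt.const_add _
    exact (hy.hasFDerivAt.comp y h).fderiv
  have hshift : Filter.Tendsto (fun y : P => (x : E3) + y) (nhds 0) (nhds (x : E3)) := by
    have : Continuous (fun y : P => (x : E3) + y) := by fun_prop
    simpa using this.tendsto 0
  have hdU : ∀ᶠ y : P in nhds 0, DifferentiableAt ℝ (radialExt u) ((x : E3) + y) := by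
    filter_upwards [hshift.eventually (hu.eventually (by simp))] with y hy
    exact hy.differentiableAt (by simp)
  have hA : ContDiffAt ℝ 2 A 0 := by
    refine ContDiffAt.comp (0 : P) (g := radialExt u) (by simpa using hu) ?_
    exact (contDiff_const.add P.subtypeL.contDiff).contDiffAt
  have hA2 : ∀ w : P, fderiv ℝ (fderiv ℝ A) 0 w w =
      fderiv ℝ (fderiv ℝ (radialExt u)) x w w := by
    intro w
    have hD : HasFDerivAt (fderiv ℝ (radialExt u)) (fderiv ℝ (fderiv ℝ (radialExt u)) x)
        ((x : E3) + (0 : P)) := by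
      simpa using ((hu.fderiv_right (m := 1) (by norm_num)).differentiableAt
        (by simp)).hasFDerivAt
    have h : HasFDerivAt (fun y : P => (x : E3) + y) P.subtypeL 0 :=
      P.subtypeL.hasFDerivAt.const_add _
    have h3 := (hD.comp (0 : P) h).clm_comp (hasFDerivAt_const P.subtypeL (0 : P))
    have h4 := (h3.congr_of_eventuallyEq (f₁ := fderiv ℝ A) (by
      filter_upwards [hdU] with y hy using hA1 y hy)).fderiv
    rw [h4]
    simp
  have hlt : ∀ᶠ y : P in nhds 0, 0 < 4 - ‖y‖ ^ 2 := eventually_norm_lt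
  -- the chart in terms of `radChange`
  have hchart : ∀ᶠ y : P in nhds 0,
      u (stereoInvFun (norm_neg_coe x) y) = A (radChange y) := by
    filter_upwards [hlt] with y hy
    rw [← radialExt_coe u, stereoInvFun_apply]
    have e : (x : E3) + (radChange y : E3) = ((‖y‖ ^ 2 + 4) / (4 - ‖y‖ ^ 2)) •
        ((‖y‖ ^ 2 + 4)⁻¹ • ((4 : ℝ) • (y : E3) + (‖y‖ ^ 2 - 4) • (-(x : E3)))) := by
      have h4 : ‖y‖ ^ 2 + 4 ≠ 0 := by positivity
      rw [smul_smul, smul_add, smul_smul, smul_neg, smul_neg, smul_smul, add_comm]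
      have e1 : (‖y‖ ^ 2 + 4) / (4 - ‖y‖ ^ 2) * (‖y‖ ^ 2 + 4)⁻¹ = (4 - ‖y‖ ^ 2)⁻¹ := by
        field_simp
      rw [e1]
      have e2 : (4 - ‖y‖ ^ 2)⁻¹ * (‖y‖ ^ 2 - 4) = -1 := by
        field_simp
        ring
      rw [e2, neg_smul, one_smul, neg_neg]
      congr 1
      change (radFactor y) • (y : E3) = _
      congr 1
      simp only [radFactor]
      field_simp
    change _ = radialExt u ((x : E3) + (radChange y : E3))
    rw [e]
    exact (radialExt_smul u (by positivity) _).symm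
  have hmain := fderiv_fderiv_comp A radChange hA (by simp [radChange])
    (by filter_upwards [hlt] with y hy using (hasFDerivAt_radChange y hy).differentiableAt)
    (by rw [(hasFDerivAt_radChange (0 : P) (by simp)).fderiv]; simp [radFactor])
    hasFDerivAt_fderiv_radChange
  -- the logarithm of the conformal factor
  have hlog : (fun y => Real.log (chartFactor u x y)) =ᶠ[nhds 0]
      (2 : ℝ) • (fun y => A (radChange y)) + (2 : ℝ) • fun y : P => Real.log (4 / (‖y‖ ^ 2 + 4)) := by
    filter_upwards [hchart] with y hy
    rw [chartFactor, Real.log_mul (Real.exp_ne_zero _) (by positivity), Real.log_exp,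
      Real.log_pow, hy]
    simp
  have hAψ : ContDiffAt ℝ 2 (fun y => A (radChange y)) 0 :=
    ContDiffAt.comp (0 : P) (g := A) (by simpa [radChange] using hA) contDiffAt_radChange
  have hlap : Laplacian.laplacian (fun y => Real.log (chartFactor u x y)) (0 : P) =
      2 * sphereLaplacian u x - 2 := by
    rw [(InnerProductSpace.laplacian_congr_nhds hlog).eq_of_nhds,
      ContDiffAt.laplacian_add (f₁ := (2 : ℝ) • fun y => A (radChange y))
        (f₂ := (2 : ℝ) • fun y : P => Real.log (4 / (‖y‖ ^ 2 + 4))) (hAψ.const_smul (2 : ℝ))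
        (contDiff_normSq_factor.contDiffAt.const_smul (2 : ℝ)),
      InnerProductSpace.laplacian_smul _ hAψ,
      InnerProductSpace.laplacian_smul _ contDiff_normSq_factor.contDiffAt,
      laplacian_eq_sum b, laplacian_eq_sum b, hmain.fderiv, hasFDerivAt_logFactor.fderiv,
      sphereLaplacian, laplacian_radialExt_eq u x hu b]
    simp only [hA2]
    have hb : ∀ i, innerSL ℝ (b i) (b i) = (1 : ℝ) := fun i => by
      rw [innerSL_apply_apply, real_inner_self_eq_norm_sq, b.norm_eq_one, one_pow]
    simp [Fin.sum_univ_two]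
    linear_combination -(hb 0) - hb 1
  have h0 : chartFactor u x 0 = Real.exp (2 * u x) := by
    have : u (stereoInvFun (norm_neg_coe x) 0) = u x := by
      congr 1
      apply Subtype.ext
      simp
    rw [chartFactor, this]
    simp
  rw [gaussCurvature, isothermalCurvature, hlap, h0, Real.exp_neg]
  have := Real.exp_ne_zero (2 * u x)
  field_simp
  ring

end curvature

section spaces

theorem radialExt_add (f g : S2 → ℝ) : radialExt (f + g) = radialExt f + radialExt g := by
  funext x
  by_cases h : x = 0 <;> simp [radialExt, h]

theorem radialExt_const_smul (c : ℝ) (f : S2 → ℝ) : radialExt (c • f) = c • radialExt f := by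
  funext x
  by_cases h : x = 0 <;> simp [radialExt, h]

/-- The real vector space of functions on `S²` of class `C^{k,α}`. -/
def holderSubmodule (k : ℕ) (α : ℝ) : Submodule ℝ (S2 → ℝ) where
  carrier := {f | HolderReg k α (radialExt f)}
  zero_mem' := by
    have h : radialExt (0 : S2 → ℝ) = fun _ => 0 := by
      funext x
      by_cases h : x = 0 <;> simp [radialExt, h]
    change HolderReg k α (radialExt 0)
    rw [h]
    exact ⟨contDiffOn_const, 0, fun x y => by simp⟩
  add_mem' := fun {f g} hf hg => by
    change HolderReg k α (radialExt (f + g))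
    rw [radialExt_add]
    exact HolderReg.add hf hg
  smul_mem' := fun c f hf => by
    change HolderReg k α (radialExt (c • f))
    rw [radialExt_const_smul]
    exact HolderReg.const_smul c hf

/-- The Hölder space `C^{k,α}(S²)`. -/
def HolderFun (k : ℕ) (α : ℝ) : Type := holderSubmodule k α

variable {k : ℕ} {α : ℝ}

instance : AddCommGroup (HolderFun k α) := inferInstanceAs (AddCommGroup (holderSubmodule k α))

instance : Module ℝ (HolderFun k α) := inferInstanceAs (Module ℝ (holderSubmodule k α))

instance : CoeFun (HolderFun k α) (fun _ => S2 → ℝ) := ⟨fun f => f.1⟩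

theorem HolderFun.reg (f : HolderFun k α) : HolderReg k α (radialExt f) := f.2

theorem HolderFun.ext {f g : HolderFun k α} (h : ∀ x, f x = g x) : f = g :=
  Subtype.ext (funext h)

theorem HolderFun.add_apply (f g : HolderFun k α) (x : S2) : (f + g) x = f x + g x := rfl

theorem HolderFun.smul_apply (c : ℝ) (f : HolderFun k α) (x : S2) : (c • f) x = c * f x := rfl

theorem HolderFun.zero_apply (x : S2) : (0 : HolderFun k α) x = 0 := rfl

/-- The `j`-th derivative along the sphere of the extension of `f` homogeneous of degree `0`. -/
def HolderFun.D (j : ℕ) (f : HolderFun k α) (x : S2) : E3 [×j]→L[ℝ] ℝ :=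
  iteratedFDeriv ℝ j (radialExt f) x

/-- The Hölder difference quotient of the `k`-th derivative (zero on the diagonal). -/
def HolderFun.quot (f : HolderFun k α) (p : S2 × S2) : ℝ :=
  ‖f.D k p.1 - f.D k p.2‖ / ‖(p.1 : E3) - p.2‖ ^ α

/-- The norm of `C^{k,α}(S²)`: suprema of the derivatives of order at most `k`, plus the
`α`-Hölder seminorm of the `k`-th derivative. -/
instance : Norm (HolderFun k α) :=
  ⟨fun f => (∑ j ∈ Finset.range (k + 1), ⨆ x : S2, ‖f.D j x‖) + ⨆ p : S2 × S2, f.quot p⟩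

theorem HolderFun.norm_def (f : HolderFun k α) :
    ‖f‖ = (∑ j ∈ Finset.range (k + 1), ⨆ x : S2, ‖f.D j x‖) + ⨆ p : S2 × S2, f.quot p := rfl

theorem HolderFun.contDiffAt (f : HolderFun k α) {j : ℕ} (hj : j ≤ k) (x : S2) :
    ContDiffAt ℝ j (radialExt f) x :=
  (f.reg.contDiffAt (S2.ne_zero x)).of_le (by exact_mod_cast hj)

theorem HolderFun.D_add (f g : HolderFun k α) {j : ℕ} (hj : j ≤ k) (x : S2) :
    (f + g).D j x = f.D j x + g.D j x := by
  have h : radialExt (f + g : HolderFun k α) = radialExt f + radialExt g := radialExt_add _ _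
  rw [HolderFun.D, h, iteratedFDeriv_add_apply (f.contDiffAt hj x) (g.contDiffAt hj x)]
  rfl

theorem HolderFun.D_smul (c : ℝ) (f : HolderFun k α) {j : ℕ} (hj : j ≤ k) (x : S2) :
    (c • f).D j x = c • f.D j x := by
  have h : radialExt (c • f : HolderFun k α) = c • radialExt f := radialExt_const_smul _ _
  rw [HolderFun.D, h, iteratedFDeriv_const_smul_apply (f.contDiffAt hj x)]
  rfl

theorem HolderFun.norm_D_zero (f : HolderFun k α) (x : S2) : ‖f.D 0 x‖ = |f x| := by
  rw [HolderFun.D, norm_iteratedFDeriv_zero, radialExt_coe, Real.norm_eq_abs]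

theorem HolderFun.bddAbove_D (f : HolderFun k α) {j : ℕ} (hj : j ≤ k) :
    BddAbove (Set.range fun x : S2 => ‖f.D j x‖) := by
  have h : ContDiffOn ℝ 0 (iteratedFDeriv ℝ j (radialExt f)) {0}ᶜ := by
    have := contDiffOn_iteratedFDeriv (F := radialExt f) (j := j) (n := 0)
      (f.reg.1.of_le (by exact_mod_cast (by omega : 0 + j ≤ k)))
    exact_mod_cast this
  obtain ⟨C, -, hC⟩ := exists_bound (k := 0) (by exact_mod_cast h)
  exact ⟨C, by rintro _ ⟨x, rfl⟩; exact hC x⟩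

theorem HolderFun.bddAbove_quot (f : HolderFun k α) :
    BddAbove (Set.range fun p : S2 × S2 => f.quot p) := by
  obtain ⟨C, hC⟩ := f.reg.2
  refine ⟨max C 0, ?_⟩
  rintro _ ⟨⟨x, y⟩, rfl⟩
  by_cases hxy : x = y
  · subst hxy
    simp [HolderFun.quot]
  · have h : 0 < ‖(x : E3) - y‖ ^ α :=
      Real.rpow_pos_of_pos (norm_pos_iff.mpr (sub_ne_zero.mpr fun e => hxy (Subtype.ext e))) _
    exact ((div_le_iff₀ h).mpr (hC x y)).trans (le_max_left _ _)

instance : Nonempty S2 := ⟨⟨EuclideanSpace.single 0 1, by simp⟩⟩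

theorem HolderFun.quot_nonneg (f : HolderFun k α) (p : S2 × S2) : 0 ≤ f.quot p :=
  div_nonneg (norm_nonneg _) (Real.rpow_nonneg (norm_nonneg _) _)

theorem HolderFun.core : NormedSpace.Core ℝ (HolderFun k α) where
  norm_nonneg f := add_nonneg
    (Finset.sum_nonneg fun j _ => Real.iSup_nonneg fun x => norm_nonneg _)
    (Real.iSup_nonneg f.quot_nonneg)
  norm_smul c f := by
    rw [HolderFun.norm_def, HolderFun.norm_def, mul_add, Finset.mul_sum]
    congr 1
    · refine Finset.sum_congr rfl fun j hj => ?_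
      rw [Real.mul_iSup_of_nonneg (norm_nonneg c)]
      refine iSup_congr fun x => ?_
      rw [f.D_smul c (by simpa [Nat.lt_succ_iff] using hj), norm_smul]
    · rw [Real.mul_iSup_of_nonneg (norm_nonneg c)]
      refine iSup_congr fun p => ?_
      have h : c • f.D k p.1 - c • f.D k p.2 = c • (f.D k p.1 - f.D k p.2) :=
        (smul_sub c _ _).symm
      rw [HolderFun.quot, f.D_smul c le_rfl, f.D_smul c le_rfl, h, norm_smul,
        HolderFun.quot, mul_div_assoc]
  norm_triangle f g := by
    rw [HolderFun.norm_def, HolderFun.norm_def, HolderFun.norm_def, add_add_add_comm,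
      ← Finset.sum_add_distrib]
    refine add_le_add (Finset.sum_le_sum fun j hj => ?_) ?_
    · have hj' : j ≤ k := by simpa [Nat.lt_succ_iff] using hj
      refine ciSup_le fun x => ?_
      rw [f.D_add g hj']
      exact (norm_add_le _ _).trans
        (add_le_add (le_ciSup (f.bddAbove_D hj') x) (le_ciSup (g.bddAbove_D hj') x))
    · refine ciSup_le fun p => ?_
      refine le_trans ?_ (add_le_add (le_ciSup f.bddAbove_quot p) (le_ciSup g.bddAbove_quot p))
      rw [HolderFun.quot, HolderFun.quot, HolderFun.quot, f.D_add g le_rfl, f.D_add g le_rfl,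
        add_sub_add_comm, ← add_div]
      exact div_le_div_of_nonneg_right (norm_add_le _ _) (Real.rpow_nonneg (norm_nonneg _) _)
  norm_eq_zero_iff f := by
    constructor
    · intro h
      rw [HolderFun.norm_def] at h
      have h1 : ∀ j ∈ Finset.range (k + 1), 0 ≤ ⨆ x : S2, ‖f.D j x‖ :=
        fun j _ => Real.iSup_nonneg fun x => norm_nonneg _
      have h2 : 0 ≤ ⨆ p : S2 × S2, f.quot p := Real.iSup_nonneg f.quot_nonneg
      have h3 := (add_eq_zero_iff_of_nonneg (Finset.sum_nonneg h1) h2).mp h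
      have h4 := (Finset.sum_eq_zero_iff_of_nonneg h1).mp h3.1 0 (by simp)
      refine HolderFun.ext fun x => ?_
      have h5 := le_ciSup (f.bddAbove_D (Nat.zero_le k)) x
      rw [h4] at h5
      have h6 : ‖f.D 0 x‖ = 0 := le_antisymm h5 (norm_nonneg _)
      rw [f.norm_D_zero, abs_eq_zero] at h6
      exact h6
    · rintro rfl
      have hz : (0 : HolderFun k α) = (0 : ℝ) • (0 : HolderFun k α) := by simp
      have hD : ∀ j ≤ k, ∀ x : S2, (0 : HolderFun k α).D j x = 0 := by
        intro j hj x
        rw [hz, HolderFun.D_smul _ _ hj, zero_smul]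
      have hq : ∀ p : S2 × S2, (0 : HolderFun k α).quot p = 0 := by
        intro p
        rw [HolderFun.quot, hD k le_rfl, hD k le_rfl]
        simp
      rw [HolderFun.norm_def]
      simp only [hq, Real.iSup_const_zero, add_zero]
      refine Finset.sum_eq_zero fun j hj => ?_
      simp [hD j (by simpa [Nat.lt_succ_iff] using hj)]

instance : NormedAddCommGroup (HolderFun k α) := NormedAddCommGroup.ofCore HolderFun.core

instance : NormedSpace ℝ (HolderFun k α) := NormedSpace.ofCore HolderFun.core

theorem holderReg_linear (hα : α ∈ Set.Ioo (0 : ℝ) 1) (k : ℕ) (a : E3) :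
    HolderReg k α (radialExt fun x : S2 => inner ℝ a (x : E3)) := by
  have h : HolderReg k α fun x : E3 => ‖x‖⁻¹ * inner ℝ a x := by
    refine HolderReg.of_contDiffOn hα (ContDiffOn.mul ?_ ?_)
    · intro x hx
      exact ((contDiffAt_norm ℝ hx).inv (norm_ne_zero_iff.mpr hx)).contDiffWithinAt
    · exact (contDiff_const.inner ℝ contDiff_id).contDiffOn
  refine h.congr fun x hx => ?_
  rw [radialExt_of_ne _ hx]
  simp [inner_smul_right]

/-- The restriction to `S²` of the linear function `x ↦ ⟨a, x⟩` on `ℝ³`. -/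
def linearFun {α : ℝ} (hα : α ∈ Set.Ioo (0 : ℝ) 1) (k : ℕ) (a : E3) : HolderFun k α :=
  ⟨fun x => inner ℝ a (x : E3), holderReg_linear hα k a⟩

theorem holderReg_gaussCurvature {m : ℕ} (hm : 4 ≤ m) (hα : α ∈ Set.Ioo (0 : ℝ) 1)
    (u : HolderFun m α) : HolderReg (m - 2) α (radialExt (gaussCurvature u)) := by
  obtain ⟨k, rfl⟩ : ∃ k, m = k + 2 := ⟨m - 2, by omega⟩
  change HolderReg k α _
  have hU : HolderReg (k + 2) α (radialExt u) := u.reg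
  have h2 : HolderReg k α fun x : E3 => Laplacian.laplacian (radialExt u) x := by
    have hs : HolderReg k α (fderiv ℝ (fderiv ℝ (radialExt u))) := hU.fderiv.fderiv
    have hi : ∀ i : Fin 3, HolderReg k α fun x => fderiv ℝ (fderiv ℝ (radialExt u)) x
        (EuclideanSpace.basisFun (Fin 3) ℝ i) (EuclideanSpace.basisFun (Fin 3) ℝ i) := by
      intro i
      let w := EuclideanSpace.basisFun (Fin 3) ℝ i
      exact ((hs.clm_comp hα (ContinuousLinearMap.apply ℝ (E3 →L[ℝ] ℝ) w)).clm_comp hα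
        (ContinuousLinearMap.apply ℝ ℝ w))
    refine HolderReg.congr ((hi 0).add ((hi 1).add (hi 2))) fun x _ => ?_
    rw [laplacian_eq_sum (EuclideanSpace.basisFun (Fin 3) ℝ)]
    simp only [Fin.sum_univ_three, Pi.add_apply]
    ring
  have hn : HolderReg k α fun x : E3 => ‖x‖ ^ 2 :=
    HolderReg.of_contDiffOn hα (contDiff_norm_sq ℝ).contDiffOn
  have h1 : HolderReg k α fun _ : E3 => (1 : ℝ) := HolderReg.of_contDiffOn hα contDiffOn_const
  have he : HolderReg k α fun x : E3 => Real.exp (((-2 : ℝ) • radialExt u) x) :=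
    HolderReg.exp hα ((hU.of_succ hα).const_smul (-2))
  refine HolderReg.congr (he.mul hα (h1.add ((hn.mul hα h2).const_smul (-1)))) fun x hx => ?_
  have hx' : x ≠ 0 := hx
  have hpos : 0 < ‖x‖⁻¹ := inv_pos.mpr (norm_pos_iff.mpr hx')
  have hsc := radialExt_laplacian_smul u hpos x
  rw [radialExt_of_ne _ hx', gaussCurvature_eq _ _ (by exact_mod_cast u.contDiffAt (j := 2) (by omega) _), sphereLaplacian,
    ← radialExt_coe u, radialExt_smul u hpos]
  simp only [Pi.add_apply, Pi.smul_apply, smul_eq_mul]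
  rw [← hsc]
  have hnx : ‖x‖ ≠ 0 := norm_ne_zero_iff.mpr hx'
  congr 1
  · congr 1
    ring
  · field_simp
    ring

/-- The curvature map `π : C^{m,α}(S²) → C^{m-2,α}(S²)`, sending `u` to the Gauss curvature of
`e^{2u} g`. -/
def curvatureMap {m : ℕ} (hm : 4 ≤ m) {α : ℝ} (hα : α ∈ Set.Ioo (0 : ℝ) 1) (u : HolderFun m α) :
    HolderFun (m - 2) α :=
  ⟨gaussCurvature u, holderReg_gaussCurvature hm hα u⟩

end spaces

/-- `C₊`: the functions of class `C^{k,α}` that are positive somewhere. -/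
def Cplus (k : ℕ) (α : ℝ) : Set (HolderFun k α) := {K | ∃ x, 0 < K x}

/-- `𝒞`: no local maximum at a point where `K` vanishes. -/
def setC (k : ℕ) (α : ℝ) : Set (HolderFun k α) :=
  {K | K ∈ Cplus k α ∧ ∀ x : S2, K x = 0 → ¬ IsLocalMax K x}

/-- `𝒩`: `|∇K|(p) + |ΔK|(p) > 0` wherever `K(p) > 0`. -/
def setN (k : ℕ) (α : ℝ) : Set (HolderFun k α) :=
  {K | K ∈ Cplus k α ∧ ∀ x : S2, 0 < K x → 0 < ‖sphereGradient K x‖ + |sphereLaplacian K x|}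

/-- `𝒦 = 𝒞 ∩ 𝒩`. -/
def setK (k : ℕ) (α : ℝ) : Set (HolderFun k α) := setC k α ∩ setN k α

section degree

variable {X Y : Type} [NormedAddCommGroup X] [NormedSpace ℝ X] [NormedAddCommGroup Y]
  [NormedSpace ℝ Y]

/-- The determinant of `1 + S` for an operator `S` of finite rank: the determinant of the
restriction of `1 + S` to the range of `S`. -/
def finiteRankDet (S : X →L[ℝ] X) : ℝ :=
  LinearMap.det (LinearMap.id + S.toLinearMap.rangeRestrict ∘ₗ S.toLinearMap.range.subtype)

/-- A corrector of `L` is an operator `A` of finite rank such that `L + A` is an isomorphism; it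
exists if and only if `L` is Fredholm of index `0`. -/
def IsCorrector (L A : X →L[ℝ] Y) : Prop :=
  FiniteDimensional ℝ A.toLinearMap.range ∧ (L + A).IsInvertible

/-- Correctors `A`, `B` of `L` are equivalent if `(L + B)⁻¹ (L + A) = 1 + (L + B)⁻¹ (A - B)` has
positive determinant. There are exactly two classes, the orientations of `L`. -/
def CorrectorEquiv (L A B : X →L[ℝ] Y) : Prop :=
  0 < finiteRankDet ((L + B).inverse ∘L (A - B))

/-- An orientation of a Fredholm map `F` of index `0`: an orientation (a class of
equivalent correctors) of each derivative of `F`, depending continuously on the point. -/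
structure FredholmOrientation (F : X → Y) where
  /-- The positively oriented correctors of the derivative. -/
  correctors : X → Set (X →L[ℝ] Y)
  isClass : ∀ u, ∃ A, IsCorrector (fderiv ℝ F u) A ∧
    correctors u = {B | IsCorrector (fderiv ℝ F u) B ∧ CorrectorEquiv (fderiv ℝ F u) A B}
  continuous : ∀ u, ∀ A ∈ correctors u, ∀ᶠ v in nhds u, A ∈ correctors v

open Classical in
/-- The sign of an invertible derivative: `+1` if it preserves orientation, i.e. if the zero
corrector is positively oriented, and `-1` if it reverses orientation. -/
def FredholmOrientation.sign {F : X → Y} (o : FredholmOrientation F) (u : X) : ℤ :=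
  if (0 : X →L[ℝ] Y) ∈ o.correctors u then 1 else -1

/-- `y` is a regular value of `F`: the derivative is an isomorphism at each preimage of `y`. -/
def IsRegularValue (F : X → Y) (y : Y) : Prop :=
  ∀ u, F u = y → (fderiv ℝ F u).IsInvertible

/-- The restriction `F⁻¹(C) → C` of `F` to the preimage of `C` has degree `d`, as computed at a
regular value `y` in `C` with finite fibre: `d = ∑ sign (DF_u)` over the preimages `u` of `y`. (For
`F⁻¹(C) → C` proper and `C` open and connected this does not depend on `y`.) -/
def HasDegree (F : X → Y) (o : FredholmOrientation F) (C : Set Y) (d : ℤ) : Prop :=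
  ∃ y ∈ C, IsRegularValue F y ∧ (F ⁻¹' {y}).Finite ∧ ∑ᶠ u ∈ F ⁻¹' {y}, o.sign u = d

end degree

/-- `C` is a path component of `S`. -/
def IsPathComponentOf {Y : Type} [TopologicalSpace Y] (C S : Set Y) : Prop :=
  ∃ y ∈ S, C = pathComponentIn S y

/-- `C` is a path component of `𝒦` over which the curvature map has degree `0`. -/
def IsDegreeZeroComponent {m : ℕ} (hm : 4 ≤ m) {α : ℝ} (hα : α ∈ Set.Ioo (0 : ℝ) 1)
    (C : Set (HolderFun (m - 2) α)) : Prop :=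
  IsPathComponentOf C (setK (m - 2) α) ∧
    ∀ o : FredholmOrientation (curvatureMap hm hα), HasDegree (curvatureMap hm hα) o C 0

end Nirenberg
end

/-!
For large `|a|` the function `f = K + ⟨a, ·⟩` is a small perturbation, up to scaling, of a linear
function, and there is a conformal field `X` of the sphere along which `f` is monotone. This
contradicts the Kazdan–Warner identity `∫ e^{2u} X f = 0`, valid for every conformal field `X` if
`f` is the curvature of `e^{2u} g`; so `f` is not a curvature function.

The field `X` must vanish at all critical points of `f`. It is chosen as the field that vanishes at
the maximum `p` and the minimum `q` of `f` and flows from `q` to `p`. The derivative `X f` is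
`(1 - ⟨x, q⟩) ⟨∇f, p⟩ - (1 - ⟨x, p⟩) ⟨∇f, q⟩`, and as `∇f` vanishes at `p` and `q`, both terms are
those of a linear function up to a multiple of `(1 - ⟨x, p⟩) (1 - ⟨x, q⟩)` that does not grow with
`a` (`le_inner_gradient_pole`, `exists_conformal_field_pos`).

The Kazdan–Warner identity is proved on `ℝ³ ∖ {0}` for homogeneous extensions: `e^{2u} X K` is the
divergence of a field tangential to the spheres about the origin, so that its integral against any
radial weight vanishes (`integral_shell_mul_divergence`, `integral_shell_exp_mul_fderiv_eq_zero`,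
`not_exists_inner_conformal_pos`).

For large `|a|` the function `K + ⟨a, ·⟩` also lies in the path component of the linear functions in
`𝒦`: the segment to `⟨a, ·⟩` stays in `𝒦`, and so does every nonzero linear function. The fibre of
the curvature map over `⟨a, ·⟩` is empty for large `|a|`. Thus `⟨a, ·⟩` is a regular value in this
component with empty fibre, and the degree is the empty sum for every orientation.
-/

noncomputable section

namespace Nirenberg

open MeasureTheory

open scoped RealInnerProductSpace

/-! ### The divergence theorem on spheres -/

/-- The standard basis of `ℝ³`. -/
abbrev stdBasis : OrthonormalBasis (Fin 3) ℝ E3 := EuclideanSpace.basisFun (Fin 3) ℝ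

/-- The Euclidean divergence of a vector field on `ℝ³`. -/
def divergence (V : E3 → E3) (x : E3) : ℝ := ∑ i, ⟪stdBasis i, fderiv ℝ V x (stdBasis i)⟫

theorem divergence_smul {f : E3 → ℝ} {V : E3 → E3} {x : E3} (hf : DifferentiableAt ℝ f x)
    (hV : DifferentiableAt ℝ V x) :
    divergence (fun y => f y • V y) x = f x * divergence V x + fderiv ℝ f x (V x) := by
  have h : fderiv ℝ f x (V x) = ∑ i, ⟪stdBasis i, V x⟫ * fderiv ℝ f x (stdBasis i) := by
    conv_lhs => rw [← stdBasis.sum_repr' (V x)]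
    simp only [map_sum, map_smul, smul_eq_mul]
  simp only [divergence]
  rw [fderiv_fun_smul hf hV, h, Finset.mul_sum, ← Finset.sum_add_distrib]
  refine Finset.sum_congr rfl fun i _ => ?_
  simp only [add_apply, smul_apply,
    ContinuousLinearMap.smulRight_apply, inner_add_right, inner_smul_right]
  ring

theorem divergence_add {V W : E3 → E3} {x : E3} (hV : DifferentiableAt ℝ V x)
    (hW : DifferentiableAt ℝ W x) :
    divergence (fun y => V y + W y) x = divergence V x + divergence W x := by
  simp only [divergence]
  rw [fderiv_fun_add hV hW, ← Finset.sum_add_distrib]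
  simp only [add_apply, inner_add_right]

theorem integral_divergence_eq_zero {V : E3 → E3} (hV : ContDiff ℝ 1 V)
    (hc : HasCompactSupport V) : ∫ x, divergence V x = 0 := by
  have hcont : ∀ i, Continuous fun x => ⟪stdBasis i, fderiv ℝ V x (stdBasis i)⟫ := fun i =>
    continuous_const.inner ((hV.continuous_fderiv (by simp)).clm_apply continuous_const)
  have hsupp : ∀ i, HasCompactSupport fun x => ⟪stdBasis i, fderiv ℝ V x (stdBasis i)⟫ := fun i =>
    (hc.fderiv ℝ).comp_left (g := fun L : E3 →L[ℝ] E3 => ⟪stdBasis i, L (stdBasis i)⟫) (by simp)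
  simp only [divergence]
  rw [integral_finsetSum _ fun i _ => (hcont i).integrable_of_hasCompactSupport (hsupp i)]
  refine Finset.sum_eq_zero fun i _ => ?_
  have hd : ∀ x, fderiv ℝ (fun y => ⟪stdBasis i, V y⟫) x (stdBasis i) =
      ⟪stdBasis i, fderiv ℝ V x (stdBasis i)⟫ := fun x => by
    rw [fderiv_inner_apply ℝ (differentiableAt_const _) (hV.differentiable (by simp) x)]
    simp
  have h := integral_mul_fderiv_eq_neg_fderiv_mul_of_integrable (μ := (volume : Measure E3))
    (f := fun _ => (1 : ℝ)) (g := fun y => ⟪stdBasis i, V y⟫) (v := stdBasis i)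
    (by simp)
    (by simpa only [hd, one_mul] using (hcont i).integrable_of_hasCompactSupport (hsupp i))
    (by
      simp only [one_mul]
      exact (continuous_const.inner hV.continuous).integrable_of_hasCompactSupport
        (hc.comp_left (g := fun v : E3 => ⟪stdBasis i, v⟫) (by simp)))
    (fun x _ => differentiableAt_const _)
    (fun x _ => (differentiableAt_const _).inner ℝ (hV.differentiable (by simp) x))
  simp only [hd, one_mul, fderiv_fun_const, Pi.zero_apply, zero_apply, zero_mul,
    integral_zero, neg_zero] at h
  exact h

/-- `w` is `C¹` and supported in `[1/2, 3/2]`, so that `x ↦ w |x|` is a radial weight supported in a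
shell about the unit sphere, away from the singularity of homogeneous extensions at the origin. -/
structure IsShellWeight (w : ℝ → ℝ) : Prop where
  contDiff : ContDiff ℝ 1 w
  eq_zero_of_lt : ∀ t < 1 / 2, w t = 0
  eq_zero_of_gt : ∀ t, 3 / 2 < t → w t = 0

section shell

variable {w : ℝ → ℝ} {Z : Type} [NormedAddCommGroup Z] [NormedSpace ℝ Z] {V : E3 → Z}

theorem IsShellWeight.eventually_eq_zero (hw : IsShellWeight w) :
    (fun x => w ‖x‖ • V x) =ᶠ[nhds 0] fun _ => 0 := by
  have h : ∀ᶠ x : E3 in nhds 0, ‖x‖ < 1 / 2 :=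
    continuous_norm.continuousAt.eventually (gt_mem_nhds (by simp))
  filter_upwards [h] with x hx
  rw [hw.eq_zero_of_lt _ hx, zero_smul]

theorem IsShellWeight.hasCompactSupport (hw : IsShellWeight w) :
    HasCompactSupport fun x => w ‖x‖ • V x :=
  HasCompactSupport.intro (isCompact_closedBall (0 : E3) (3 / 2)) fun x hx => by
    rw [mem_closedBall_zero_iff, not_le] at hx
    rw [hw.eq_zero_of_gt _ hx, zero_smul]

theorem IsShellWeight.contDiffAt_norm (hw : IsShellWeight w) {x : E3} (hx : x ≠ 0) :
    ContDiffAt ℝ 1 (fun y : E3 => w ‖y‖) x :=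
  hw.contDiff.contDiffAt.comp x (_root_.contDiffAt_norm ℝ hx)

theorem IsShellWeight.contDiff_smul (hw : IsShellWeight w) (hV : ContDiffOn ℝ 1 V {0}ᶜ) :
    ContDiff ℝ 1 fun x => w ‖x‖ • V x := by
  rw [contDiff_iff_contDiffAt]
  intro x
  by_cases hx : x = 0
  · subst hx
    exact contDiffAt_const.congr_of_eventuallyEq hw.eventually_eq_zero
  · exact (hw.contDiffAt_norm hx).smul (hV.contDiffAt (isOpen_punct.mem_nhds hx))

theorem IsShellWeight.continuous_smul (hw : IsShellWeight w) (hV : ContinuousOn V {0}ᶜ) :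
    Continuous fun x => w ‖x‖ • V x := by
  rw [continuous_iff_continuousAt]
  intro x
  by_cases hx : x = 0
  · subst hx
    exact continuousAt_const.congr hw.eventually_eq_zero.symm
  · exact (hw.contDiffAt_norm hx).continuousAt.smul (hV.continuousAt (isOpen_punct.mem_nhds hx))

end shell

theorem exists_isShellWeight : ∃ w : ℝ → ℝ, IsShellWeight w ∧ (∀ t, 0 ≤ w t) ∧ w 1 = 1 := by
  let φ : ContDiffBump (1 : ℝ) := ⟨1 / 4, 1 / 2, by norm_num, by norm_num⟩
  have hφ : ∀ t, 1 / 2 ≤ |t - 1| → φ t = 0 := fun t ht => φ.zero_of_le_dist (by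
    rw [Real.dist_eq]; exact ht)
  refine ⟨φ, ⟨φ.contDiff, fun t ht => hφ t ?_, fun t ht => hφ t ?_⟩, fun t => φ.nonneg, ?_⟩
  · rw [abs_of_neg (by linarith)]; linarith
  · rw [abs_of_pos (by linarith)]; linarith
  · exact φ.one_of_mem_closedBall (Metric.mem_closedBall_self φ.rIn_pos.le)

theorem IsShellWeight.id_mul {w : ℝ → ℝ} (hw : IsShellWeight w) :
    IsShellWeight fun t => t * w t :=
  ⟨contDiff_id.mul hw.contDiff, fun t ht => by rw [hw.eq_zero_of_lt t ht, mul_zero],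
    fun t ht => by rw [hw.eq_zero_of_gt t ht, mul_zero]⟩

theorem hasFDerivAt_norm {x : E3} (hx : x ≠ 0) :
    HasFDerivAt (fun y : E3 => ‖y‖) (‖x‖⁻¹ • innerSL ℝ x) x := by
  have hd := (hasFDerivAt_normSq x).sqrt (by positivity)
  refine (hd.congr_of_eventuallyEq (Filter.Eventually.of_forall fun y => ?_)).congr_fderiv ?_
  · exact (Real.sqrt_sq (norm_nonneg y)).symm
  · ext v
    simp [Real.sqrt_sq (norm_nonneg x)]
    ring

/-- The divergence theorem on the spheres about the origin, integrated over their radius: a radial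
weight has its gradient normal to a tangential field. -/
theorem integral_shell_mul_divergence {w : ℝ → ℝ} (hw : IsShellWeight w) {V : E3 → E3}
    (hV : ContDiffOn ℝ 1 V {0}ᶜ) (htan : ∀ x ≠ 0, ⟪x, V x⟫ = 0) :
    ∫ x, w ‖x‖ * divergence V x = 0 := by
  rw [← integral_divergence_eq_zero (hw.contDiff_smul hV) hw.hasCompactSupport]
  refine integral_congr_ae (Filter.Eventually.of_forall fun x => ?_)
  by_cases hx : x = 0
  · subst hx
    have h : divergence (fun x => w ‖x‖ • V x) 0 = 0 := by
      simp only [divergence]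
      rw [hw.eventually_eq_zero.fderiv_eq]
      simp
    simp only [h]
    rw [norm_zero, hw.eq_zero_of_lt 0 (by norm_num), zero_mul]
  · have hc := (hw.contDiff.differentiable (by simp) ‖x‖).hasDerivAt.comp_hasFDerivAt x
      (hasFDerivAt_norm hx)
    have h0 : fderiv ℝ (fun y : E3 => w ‖y‖) x (V x) = 0 := by
      have := hc.fderiv
      rw [Function.comp_def] at this
      rw [this]
      simp [htan x hx]
    have hcd : DifferentiableAt ℝ (fun y : E3 => w ‖y‖) x := hc.differentiableAt
    dsimp only
    rw [divergence_smul hcd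
      ((hV.contDiffAt (isOpen_punct.mem_nhds hx)).differentiableAt (by simp)), h0, add_zero]

/-! ### The Kazdan–Warner identity for a conformal field -/

section gradient

variable {u : E3 → ℝ}

theorem inner_gradient (u : E3 → ℝ) (x v : E3) : ⟪gradient u x, v⟫ = fderiv ℝ u x v := by
  rw [← toDual_gradient]; rfl

theorem contDiffOn_gradient {n : ℕ} (hu : ContDiffOn ℝ ((n + 1 : ℕ)) u {0}ᶜ) :
    ContDiffOn ℝ n (gradient u) {0}ᶜ :=
  (InnerProductSpace.toDual ℝ E3).symm.contDiff.comp_contDiffOn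
    (hu.fderiv_of_isOpen isOpen_punct (by push_cast; exact le_rfl))

theorem fderiv_gradient_apply (hu : ContDiffOn ℝ 2 u {0}ᶜ) {x : E3} (hx : x ≠ 0) (v w : E3) :
    ⟪fderiv ℝ (gradient u) x v, w⟫ = fderiv ℝ (fderiv ℝ u) x v w := by
  have h : fderiv ℝ u = fun y => InnerProductSpace.toDual ℝ E3 (gradient u y) :=
    funext fun y => toDual_gradient.symm
  have hg : DifferentiableAt ℝ (gradient u) x :=
    ((contDiffOn_gradient (n := 1) hu).contDiffAt (isOpen_punct.mem_nhds hx)).differentiableAt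
      (by simp)
  have h2 := ((InnerProductSpace.toDual ℝ E3).toContinuousLinearEquiv.hasFDerivAt.comp x
    hg.hasFDerivAt).fderiv
  rw [h]
  change _ = fderiv ℝ (⇑(InnerProductSpace.toDual ℝ E3).toContinuousLinearEquiv ∘ gradient u) x v w
  rw [h2]
  rfl

theorem inner_fderiv_gradient_comm (hu : ContDiffOn ℝ 2 u {0}ᶜ) {x : E3} (hx : x ≠ 0)
    (v w : E3) : ⟪fderiv ℝ (gradient u) x v, w⟫ = ⟪v, fderiv ℝ (gradient u) x w⟫ := by
  rw [real_inner_comm _ v, fderiv_gradient_apply hu hx, fderiv_gradient_apply hu hx]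
  exact ((hu.contDiffAt (isOpen_punct.mem_nhds hx)).isSymmSndFDerivAt (by simp)) v w

theorem divergence_gradient (hu : ContDiffOn ℝ 2 u {0}ᶜ) {x : E3} (hx : x ≠ 0) :
    divergence (gradient u) x = Laplacian.laplacian u x := by
  rw [laplacian_eq_sum stdBasis]
  refine Finset.sum_congr rfl fun i _ => ?_
  rw [real_inner_comm, fderiv_gradient_apply hu hx]

end gradient

/-- The Kazdan–Warner identity `∫ e^{2u} X K = 0`, with a radial weight, for a tangential field `X`
with `2⟨v, DX v⟩ = τ |v|²` for tangential `v` (that is, conformal on each sphere). The integrand is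
the divergence of the tangential field `(e^{2u} K - g - |x|²|∇u|²) X + |x|² (2 X u + τ) ∇u`; here `g`
is an auxiliary function that makes up for the terms of degree at most one in `u` (`hbal`). -/
theorem integral_shell_exp_mul_fderiv_eq_zero {u K g τ : E3 → ℝ} {X : E3 → E3}
    (hu : ContDiffOn ℝ 2 u {0}ᶜ) (hK : ContDiffOn ℝ 1 K {0}ᶜ) (hg : ContDiffOn ℝ 1 g {0}ᶜ)
    (hτ : ContDiffOn ℝ 1 τ {0}ᶜ) (hX : ContDiffOn ℝ 1 X {0}ᶜ)
    (heuler : ∀ x ≠ 0, ⟪x, gradient u x⟫ = 0)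
    (heq : ∀ x ≠ 0, Real.exp (2 * u x) * K x = 1 - ‖x‖ ^ 2 * Laplacian.laplacian u x)
    (hXtan : ∀ x ≠ 0, ⟪x, X x⟫ = 0)
    (hdiv : ∀ x ≠ 0, divergence X x = τ x)
    (hconf : ∀ x ≠ 0, ∀ v, ⟪x, v⟫ = 0 → 2 * ⟪fderiv ℝ X x v, v⟫ = τ x * ‖v‖ ^ 2)
    (hbal : ∀ x ≠ 0, 2 * ⟪X x, gradient u x⟫ + τ x - g x * τ x - fderiv ℝ g x (X x) +
      ‖x‖ ^ 2 * fderiv ℝ τ x (gradient u x) = 0)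
    {w : ℝ → ℝ} (hw : IsShellWeight w) :
    ∫ x, w ‖x‖ * (Real.exp (2 * u x) * fderiv ℝ K x (X x)) = 0 := by
  set G : E3 → E3 := gradient u with hG
  have hG1 : ContDiffOn ℝ 1 G {0}ᶜ := contDiffOn_gradient (n := 1) hu
  have hu1 : ContDiffOn ℝ 1 u {0}ᶜ := hu.of_le (by norm_num)
  have hN : ContDiff ℝ 1 fun x : E3 => ‖x‖ ^ 2 := contDiff_norm_sq ℝ
  let f₁ : E3 → ℝ := fun x => Real.exp (2 * u x) * K x - g x - ‖x‖ ^ 2 * ‖G x‖ ^ 2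
  let f₂ : E3 → ℝ := fun x => ‖x‖ ^ 2 * (2 * ⟪X x, G x⟫ + τ x)
  have hf₁ : ContDiffOn ℝ 1 f₁ {0}ᶜ :=
    (((contDiffOn_const.mul hu1).exp.mul hK).sub hg).sub (hN.contDiffOn.mul (hG1.norm_sq ℝ))
  have hf₂ : ContDiffOn ℝ 1 f₂ {0}ᶜ :=
    hN.contDiffOn.mul ((contDiffOn_const.mul (hX.inner ℝ hG1)).add hτ)
  have hmain : ∀ x ≠ 0, divergence (fun y => f₁ y • X y + f₂ y • G y) x =
      Real.exp (2 * u x) * fderiv ℝ K x (X x) := by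
    intro x hx
    have diff : ∀ {Z : Type} [NormedAddCommGroup Z] [NormedSpace ℝ Z] {F : E3 → Z},
        ContDiffOn ℝ 1 F {0}ᶜ → DifferentiableAt ℝ F x := fun hF =>
      (hF.contDiffAt (isOpen_punct.mem_nhds hx)).differentiableAt (by simp)
    have hNd := (hasStrictFDerivAt_norm_sq x).hasFDerivAt
    have hGd := (diff hG1).hasFDerivAt
    have hd₁ : HasFDerivAt f₁ _ x := ((((diff hu1).hasFDerivAt.const_mul 2).exp.mul
      (diff hK).hasFDerivAt).sub (diff hg).hasFDerivAt).sub (hNd.mul hGd.norm_sq)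
    have hd₂ : HasFDerivAt f₂ _ x := hNd.mul
      ((((diff hX).hasFDerivAt.inner ℝ hGd).const_mul 2).add (diff hτ).hasFDerivAt)
    rw [divergence_add ((diff hf₁).fun_smul (diff hX)) ((diff hf₂).fun_smul (diff hG1)),
      divergence_smul (diff hf₁) (diff hX), divergence_smul (diff hf₂) (diff hG1), hdiv x hx,
      divergence_gradient hu hx, hd₁.fderiv, hd₂.fderiv]
    -- the curvature equation, the balance condition, conformality at `∇u`, symmetry of the Hessian
    have e1 := heq x hx
    have e2 := hbal x hx
    have e3 := hconf x hx (G x) (heuler x hx)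
    have e4 := inner_fderiv_gradient_comm hu hx (X x) (G x)
    have e5 := inner_gradient u x (X x)
    rw [← hG, real_inner_comm] at e4 e5
    simp only [f₁, f₂, add_apply, smul_apply, sub_apply, smul_eq_mul, nsmul_eq_mul,
      innerSL_apply_apply, ContinuousLinearMap.comp_apply, ContinuousLinearMap.prod_apply,
      fderivInnerCLM_apply, hXtan x hx, heuler x hx, ← e5]
    linear_combination (2 * ⟪X x, G x⟫ + τ x) * e1 + e2 + ‖x‖ ^ 2 * e3 - 2 * ‖x‖ ^ 2 * e4
  have htan : ∀ x ≠ 0, ⟪x, f₁ x • X x + f₂ x • G x⟫ = 0 := fun x hx => by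
    rw [inner_add_right, inner_smul_right, inner_smul_right, hXtan x hx, heuler x hx]
    simp
  rw [← integral_shell_mul_divergence (V := fun y => f₁ y • X y + f₂ y • G y) hw
    ((hf₁.smul hX).add (hf₂.smul hG1)) htan]
  refine integral_congr_ae (Filter.Eventually.of_forall fun x => ?_)
  by_cases hx : x = 0
  · subst hx
    simp [hw.eq_zero_of_lt 0 (by norm_num)]
  · dsimp only
    rw [hmain x hx]

/-! ### Conformal fields of the sphere -/

/-- The radial projection of a nonzero vector to the sphere. -/
def toSphere (x : E3) (hx : x ≠ 0) : S2 := ⟨‖x‖⁻¹ • x, by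
  rw [mem_sphere_zero_iff_norm, norm_smul, norm_inv, norm_norm,
    inv_mul_cancel₀ (norm_ne_zero_iff.mpr hx)]⟩

theorem radialExt_eq_toSphere (f : S2 → ℝ) {x : E3} (hx : x ≠ 0) :
    radialExt f x = f (toSphere x hx) := radialExt_of_ne f hx

theorem norm_smul_toSphere {x : E3} (hx : x ≠ 0) : ‖x‖ • (toSphere x hx : E3) = x := by
  simp [toSphere, smul_smul, norm_ne_zero_iff.mpr hx]

theorem norm_mul_radialExt_fderiv (f : S2 → ℝ) {x : E3} (hx : x ≠ 0) (v : E3) :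
    ‖x‖ * fderiv ℝ (radialExt f) x v = ⟪sphereGradient f (toSphere x hx), v⟫ := by
  rw [sphereGradient, inner_gradient,
    ← radialExt_fderiv_smul f (norm_pos_iff.mpr hx) (toSphere x hx), norm_smul_toSphere]
  rfl

theorem norm_sq_mul_radialExt_laplacian (f : S2 → ℝ) {x : E3} (hx : x ≠ 0) :
    ‖x‖ ^ 2 * Laplacian.laplacian (radialExt f) x = sphereLaplacian f (toSphere x hx) := by
  rw [sphereLaplacian, ← radialExt_laplacian_smul f (norm_pos_iff.mpr hx) (toSphere x hx),
    norm_smul_toSphere]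

theorem radialExt_fderiv_self (f : S2 → ℝ) {x : E3} (hx : DifferentiableAt ℝ (radialExt f) x) :
    fderiv ℝ (radialExt f) x x = 0 := by
  have h1 : HasDerivAt (fun t : ℝ => t • x) x 1 := by
    simpa using (hasDerivAt_id (1 : ℝ)).smul_const x
  have h2 : HasDerivAt (fun t : ℝ => radialExt f (t • x)) (fderiv ℝ (radialExt f) x x) 1 :=
    HasFDerivAt.comp_hasDerivAt_of_eq (1 : ℝ) hx.hasFDerivAt h1 (one_smul ℝ x).symm
  have h3 : HasDerivAt (fun t : ℝ => radialExt f (t • x)) 0 1 := by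
    refine (hasDerivAt_const (1 : ℝ) (radialExt f x)).congr_of_eventuallyEq ?_
    filter_upwards [lt_mem_nhds (zero_lt_one' ℝ)] with t ht
    exact radialExt_smul f ht x
  exact h2.unique h3

theorem divergence_id (x : E3) : divergence (fun y => y) x = 3 := by
  simp [divergence]

section fields

variable {u K : S2 → ℝ} {w : ℝ → ℝ}

theorem inner_gradient_radialExt_self (hu : ContDiffOn ℝ 1 (radialExt u) {0}ᶜ) {x : E3}
    (hx : x ≠ 0) : ⟪x, gradient (radialExt u) x⟫ = 0 := by
  rw [real_inner_comm, inner_gradient]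
  exact radialExt_fderiv_self u
    ((hu.contDiffAt (isOpen_punct.mem_nhds hx)).differentiableAt (by simp))

theorem curvature_equation_radialExt
    (heq : ∀ x : S2, Real.exp (2 * u x) * K x = 1 - sphereLaplacian u x) {x : E3} (hx : x ≠ 0) :
    Real.exp (2 * radialExt u x) * radialExt K x =
      1 - ‖x‖ ^ 2 * Laplacian.laplacian (radialExt u) x := by
  rw [norm_sq_mul_radialExt_laplacian u hx, radialExt_eq_toSphere u hx, radialExt_eq_toSphere K hx,
    heq]

/-- The Kazdan–Warner identity for the gradient fields of linear functions, in the extension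
`|x|² c - ⟨c, x⟩ x`, homogeneous of degree `2`, whose divergence is `-2⟨c, x⟩`. -/
theorem kazdanWarner_linear (hu : ContDiffOn ℝ 2 (radialExt u) {0}ᶜ)
    (hK : ContDiffOn ℝ 1 (radialExt K) {0}ᶜ)
    (heq : ∀ x : S2, Real.exp (2 * u x) * K x = 1 - sphereLaplacian u x) (c : E3)
    (hw : IsShellWeight w) :
    ∫ x, w ‖x‖ * (Real.exp (2 * radialExt u x) *
      fderiv ℝ (radialExt K) x (‖x‖ ^ 2 • c + (-⟪c, x⟫) • x)) = 0 := by
  have hN : ContDiff ℝ 1 fun x : E3 => ‖x‖ ^ 2 := contDiff_norm_sq ℝ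
  have hl : ContDiff ℝ 1 fun x : E3 => -⟪c, x⟫ := (contDiff_const.inner ℝ contDiff_id).neg
  have hld : ∀ x : E3, HasFDerivAt (fun x : E3 => -⟪c, x⟫) (-innerSL ℝ c) x := fun x =>
    (innerSL ℝ c).hasFDerivAt.neg
  have hX : ∀ x : E3, HasFDerivAt (fun x : E3 => ‖x‖ ^ 2 • c + (-⟪c, x⟫) • x) _ x := fun x =>
    ((hasFDerivAt_normSq x).smul_const c).add ((hld x).smul (hasFDerivAt_id x))
  have hτ : ∀ x : E3, HasFDerivAt (fun x : E3 => 2 * -⟪c, x⟫) ((2 : ℝ) • -innerSL ℝ c) x :=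
    fun x => (hld x).const_mul 2
  refine integral_shell_exp_mul_fderiv_eq_zero (g := fun _ => 1) (τ := fun x => 2 * -⟪c, x⟫)
    (X := fun x => ‖x‖ ^ 2 • c + (-⟪c, x⟫) • x) hu hK contDiffOn_const
    (contDiff_const.mul hl).contDiffOn
    ((hN.smul contDiff_const).add (hl.smul contDiff_id)).contDiffOn
    (fun x hx => inner_gradient_radialExt_self (hu.of_le (by norm_num)) hx)
    (fun x hx => curvature_equation_radialExt heq hx) ?_ ?_ ?_ ?_ hw
  · intro x _
    rw [inner_add_right, inner_smul_right, inner_smul_right, real_inner_self_eq_norm_sq,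
      real_inner_comm]
    ring
  · intro x _
    have hNd : DifferentiableAt ℝ (fun x : E3 => ‖x‖ ^ 2) x :=
      (hasFDerivAt_normSq x).differentiableAt
    rw [divergence_add (hNd.smul_const c) ((hld x).differentiableAt.fun_smul (by fun_prop)),
      divergence_smul hNd (by fun_prop), divergence_smul (hld x).differentiableAt (by fun_prop),
      divergence_id, (hasFDerivAt_normSq x).fderiv, (hld x).fderiv]
    simp [divergence, real_inner_comm]
    ring
  · intro x _ v hv
    rw [(hX x).fderiv]
    simp [inner_add_left, inner_smul_left, hv]
    ring
  · intro x hx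
    have h0 := inner_gradient_radialExt_self (hu.of_le (by norm_num)) hx
    rw [(hτ x).fderiv, inner_add_left, inner_smul_left, inner_smul_left, h0]
    simp
    ring

/-- The Kazdan–Warner identity for the rotation fields. They are free of divergence, and the linear
term `2 X u` is the derivative of `2 u`. -/
theorem kazdanWarner_skew (hu : ContDiffOn ℝ 2 (radialExt u) {0}ᶜ)
    (hK : ContDiffOn ℝ 1 (radialExt K) {0}ᶜ)
    (heq : ∀ x : S2, Real.exp (2 * u x) * K x = 1 - sphereLaplacian u x) (A : E3 →L[ℝ] E3)
    (hA : ∀ v, ⟪A v, v⟫ = 0) (hw : IsShellWeight w) :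
    ∫ x, w ‖x‖ * (Real.exp (2 * radialExt u x) * fderiv ℝ (radialExt K) x (A x)) = 0 := by
  have hu1 : ContDiffOn ℝ 1 (radialExt u) {0}ᶜ := hu.of_le (by norm_num)
  refine integral_shell_exp_mul_fderiv_eq_zero (g := fun x => 2 * radialExt u x) (τ := fun _ => 0)
    hu hK (contDiffOn_const.mul hu1) contDiffOn_const A.contDiff.contDiffOn
    (fun x hx => inner_gradient_radialExt_self hu1 hx)
    (fun x hx => curvature_equation_radialExt heq hx) ?_ ?_ ?_ ?_ hw
  · intro x _
    rw [real_inner_comm, hA]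
  · intro x _
    refine Finset.sum_eq_zero fun i _ => ?_
    rw [A.fderiv, real_inner_comm, hA]
  · intro x _ v _
    rw [A.fderiv, hA]
    simp
  · intro x hx
    have hd : DifferentiableAt ℝ (radialExt u) x :=
      (hu1.contDiffAt (isOpen_punct.mem_nhds hx)).differentiableAt (by simp)
    rw [fderiv_const_mul hd, real_inner_comm, inner_gradient]
    simp

/-- A curvature function `K` cannot increase along a conformal field, as `∫ e^{2u} X K = 0`. The
field `c - ⟨c, x⟩ x + A x`, with `A` skew, is the general conformal field of the sphere. -/
theorem not_exists_inner_conformal_pos (hu : ContDiffOn ℝ 2 (radialExt u) {0}ᶜ)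
    (hK : ContDiffOn ℝ 1 (radialExt K) {0}ᶜ)
    (heq : ∀ x : S2, Real.exp (2 * u x) * K x = 1 - sphereLaplacian u x) (c : E3)
    (A : E3 →L[ℝ] E3) (hA : ∀ v, ⟪A v, v⟫ = 0)
    (hnonneg : ∀ x : S2, 0 ≤ ⟪sphereGradient K x, c - ⟪c, (x : E3)⟫ • (x : E3) + A x⟫) :
    ¬ ∃ x : S2, 0 < ⟪sphereGradient K x, c - ⟪c, (x : E3)⟫ • (x : E3) + A x⟫ := by
  rintro ⟨y, hy⟩
  obtain ⟨w, hw, hw0, hw1⟩ := exists_isShellWeight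
  have hcu : ContinuousOn (fun x => Real.exp (2 * radialExt u x)) {0}ᶜ :=
    (contDiffOn_const.mul hu).exp.continuousOn
  have hcK : ContinuousOn (fderiv ℝ (radialExt K)) {0}ᶜ :=
    hK.continuousOn_fderiv_of_isOpen isOpen_punct (by simp)
  have hcX : Continuous fun x : E3 => ‖x‖ ^ 2 • c + (-⟪c, x⟫) • x := by fun_prop
  let P : E3 → ℝ := fun x => Real.exp (2 * radialExt u x) *
    fderiv ℝ (radialExt K) x (‖x‖ ^ 2 • c + (-⟪c, x⟫) • x)
  let Q : E3 → ℝ := fun x => Real.exp (2 * radialExt u x) * fderiv ℝ (radialExt K) x (A x)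
  have hP : ContinuousOn P {0}ᶜ := hcu.mul (hcK.clm_apply hcX.continuousOn)
  have hQ : ContinuousOn Q {0}ᶜ := hcu.mul (hcK.clm_apply A.continuous.continuousOn)
  -- the weights `w |x|` and `|x| w |x|` offset the difference in homogeneity of `P` and `Q`
  have hw' := hw.id_mul
  have cP := hw.continuous_smul hP
  have cQ := hw'.continuous_smul hQ
  have sP := hw.hasCompactSupport (V := P)
  have sQ := hw'.hasCompactSupport (V := Q)
  have hval : ∀ x : E3, ∀ hx : x ≠ 0, w ‖x‖ • P x + (‖x‖ * w ‖x‖) • Q x =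
      w ‖x‖ * Real.exp (2 * radialExt u x) * ‖x‖ *
        ⟪sphereGradient K (toSphere x hx), c - ⟪c, (toSphere x hx : E3)⟫ • (toSphere x hx : E3) +
          A (toSphere x hx)⟫ := by
    intro x hx
    rw [← norm_mul_radialExt_fderiv K hx]
    have e : ‖x‖ ^ 2 • (c - ⟪c, (toSphere x hx : E3)⟫ • (toSphere x hx : E3) +
        A (toSphere x hx)) = ‖x‖ ^ 2 • c + (-⟪c, x⟫) • x + ‖x‖ • A x := by
      conv_rhs => rw [← norm_smul_toSphere hx]
      rw [norm_smul, norm_norm, mem_sphere_zero_iff_norm.mp (toSphere x hx).2, inner_smul_right,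
        map_smul]
      module
    have e' : ‖x‖ ^ 2 * fderiv ℝ (radialExt K) x (c - ⟪c, (toSphere x hx : E3)⟫ •
        (toSphere x hx : E3) + A (toSphere x hx)) = fderiv ℝ (radialExt K) x
          (‖x‖ ^ 2 • c + (-⟪c, x⟫) • x) + ‖x‖ * fderiv ℝ (radialExt K) x (A x) := by
      rw [← smul_eq_mul, ← map_smul, e, map_add _ (_ + _), map_smul, smul_eq_mul]
    simp only [P, Q, smul_eq_mul]
    linear_combination (-(w ‖x‖ * Real.exp (2 * radialExt u x))) * e'
  have hpos : 0 < ∫ x, (w ‖x‖ • P x + (‖x‖ * w ‖x‖) • Q x) := by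
    refine (cP.add cQ).integral_pos_of_hasCompactSupport_nonneg_nonzero (x := (y : E3))
      (sP.add sQ) (fun x => ?_) ?_
    · by_cases hx : x = 0
      · subst hx
        simp [hw.eq_zero_of_lt 0 (by norm_num)]
      · simp only [Pi.zero_apply]
        rw [hval x hx]
        have := hnonneg (toSphere x hx)
        have := hw0 ‖x‖
        positivity
    · have hs : toSphere (y : E3) (S2.ne_zero y) = y := by
        apply Subtype.ext
        simp [toSphere]
      rw [hval y (S2.ne_zero y), hs, mem_sphere_zero_iff_norm.mp y.2, hw1]
      positivity
  rw [integral_add (cP.integrable_of_hasCompactSupport sP) (cQ.integrable_of_hasCompactSupport sQ)]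
    at hpos
  have h1 := kazdanWarner_linear hu hK heq c hw
  have h2 := kazdanWarner_skew hu hK heq A hA hw'
  simp only [P, Q, smul_eq_mul] at hpos
  rw [h1, h2] at hpos
  simp at hpos

end fields

/-! ### Linear perturbations with large coefficient -/

theorem S2.norm_eq (x : S2) : ‖(x : E3)‖ = 1 := mem_sphere_zero_iff_norm.mp x.2

section critical

variable {f : S2 → ℝ} {x : S2}

theorem isLocalMax_radialExt (h : IsLocalMax f x) : IsLocalMax (radialExt f) (x : E3) := by
  rw [IsLocalMax, IsMaxFilter, nhds_subtype_eq_comap, Filter.eventually_comap] at h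
  have hx := S2.ne_zero x
  have hc : Filter.Tendsto (fun y : E3 => ‖y‖⁻¹ • y) (nhds (x : E3)) (nhds (x : E3)) := by
    have hc' : ContinuousAt (fun y : E3 => ‖y‖⁻¹ • y) x :=
      (continuousAt_id.norm.inv₀ (norm_ne_zero_iff.mpr hx)).smul continuousAt_id
    simpa [ContinuousAt, S2.norm_eq x] using hc'
  filter_upwards [hc.eventually h, isOpen_punct.mem_nhds hx] with y hy hy0
  rw [radialExt_coe, radialExt_eq_toSphere f hy0]
  exact hy (toSphere y hy0) rfl

theorem sphereGradient_eq_zero_of_isLocalMax (h : IsLocalMax f x) : sphereGradient f x = 0 := by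
  rw [sphereGradient, gradient, (isLocalMax_radialExt h).fderiv_eq_zero, map_zero]

theorem sphereGradient_smul (c : ℝ) (f : S2 → ℝ) (x : S2) :
    sphereGradient (c • f) x = c • sphereGradient f x := by
  have h := congrFun (fderiv_const_smul_field (𝕜 := ℝ) (f := radialExt f) c) (x : E3)
  rw [sphereGradient, sphereGradient, gradient, gradient, radialExt_const_smul, h, Pi.smul_apply,
    map_smulₛₗ]
  simp

theorem sphereGradient_eq_zero_of_isLocalMin (h : IsLocalMin f x) : sphereGradient f x = 0 := by
  have h' := sphereGradient_eq_zero_of_isLocalMax (f := (-1 : ℝ) • f) (x := x) (by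
    simpa [Pi.neg_def] using h.neg)
  rw [sphereGradient_smul] at h'
  simpa using h'

end critical

section linear

theorem hasFDerivAt_norm_inv {x : E3} (hx : x ≠ 0) :
    HasFDerivAt (fun y : E3 => ‖y‖⁻¹) (-(‖x‖⁻¹ ^ 3) • innerSL ℝ x) x := by
  have hx' := norm_ne_zero_iff.mpr hx
  refine ((hasDerivAt_inv hx').comp_hasFDerivAt x (hasFDerivAt_norm hx)).congr_fderiv ?_
  ext v
  simp
  field_simp

theorem radialExt_linear_eqOn (a : E3) :
    Set.EqOn (radialExt fun x : S2 => ⟪a, (x : E3)⟫) (fun x => ‖x‖⁻¹ * ⟪a, x⟫) {0}ᶜ := by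
  intro x hx
  rw [radialExt_of_ne _ hx]
  simp [inner_smul_right]

theorem contDiffOn_radialExt_linear (a : E3) (n : ℕ) :
    ContDiffOn ℝ n (radialExt fun x : S2 => ⟪a, (x : E3)⟫) {0}ᶜ :=
  (holderReg_linear (α := 1 / 2) ⟨by norm_num, by norm_num⟩ n a).1

theorem gradient_radialExt_linear (a : E3) {x : E3} (hx : x ≠ 0) :
    gradient (radialExt fun x : S2 => ⟪a, (x : E3)⟫) x =
      ‖x‖⁻¹ • a + (-(⟪a, x⟫ * ‖x‖⁻¹ ^ 3)) • x := by
  refine ext_inner_right ℝ fun v => ?_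
  rw [inner_gradient, (eventuallyEq_of_eqOn (radialExt_linear_eqOn a) hx).fderiv_eq,
    ((hasFDerivAt_norm_inv hx).fun_mul (innerSL ℝ a).hasFDerivAt :
      HasFDerivAt (fun y : E3 => ‖y‖⁻¹ * ⟪a, y⟫) _ x).fderiv]
  simp [inner_add_left, inner_smul_left]
  ring

theorem sphereGradient_linear (a : E3) (x : S2) :
    sphereGradient (fun x : S2 => ⟪a, (x : E3)⟫) x = a - ⟪a, (x : E3)⟫ • (x : E3) := by
  rw [sphereGradient, gradient_radialExt_linear a (S2.ne_zero x), S2.norm_eq]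
  simp [sub_eq_add_neg]

theorem sphereLaplacian_linear (a : E3) (x : S2) :
    sphereLaplacian (fun x : S2 => ⟪a, (x : E3)⟫) x = -(2 * ⟪a, (x : E3)⟫) := by
  have hx := S2.ne_zero x
  have hd := hasFDerivAt_norm_inv hx
  have hd' : HasFDerivAt (fun y : E3 => -(⟪a, y⟫ * ‖y‖⁻¹ ^ 3)) _ (x : E3) :=
    ((innerSL ℝ a).hasFDerivAt.mul (hd.pow 3)).neg
  have e : divergence (gradient (radialExt fun x : S2 => ⟪a, (x : E3)⟫)) x =
      divergence (fun y => ‖y‖⁻¹ • a + (-(⟪a, y⟫ * ‖y‖⁻¹ ^ 3)) • y) x := by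
    simp only [divergence]
    rw [(eventuallyEq_of_eqOn (fun y hy => gradient_radialExt_linear a hy) hx).fderiv_eq]
  rw [sphereLaplacian, ← divergence_gradient (contDiffOn_radialExt_linear a 2) hx, e,
    divergence_add (hd.differentiableAt.smul_const a)
      (hd'.differentiableAt.fun_smul differentiableAt_fun_id),
    divergence_smul hd.differentiableAt (differentiableAt_const a),
    divergence_smul hd'.differentiableAt differentiableAt_fun_id, divergence_id,
    hd.fderiv, hd'.fderiv]
  simp [divergence, real_inner_comm]
  ring

theorem sphereGradient_add_linear {K : S2 → ℝ} (hK : ContDiffOn ℝ 2 (radialExt K) {0}ᶜ) (a : E3)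
    (x : S2) : sphereGradient (K + fun x : S2 => ⟪a, (x : E3)⟫) x =
      sphereGradient K x + (a - ⟪a, (x : E3)⟫ • (x : E3)) := by
  have hx := isOpen_punct.mem_nhds (S2.ne_zero x)
  rw [← sphereGradient_linear, sphereGradient, gradient, radialExt_add,
    fderiv_add ((hK.contDiffAt hx).differentiableAt (by simp))
      (((contDiffOn_radialExt_linear a 2).contDiffAt hx).differentiableAt (by simp)), map_add]
  rfl

theorem sphereLaplacian_add_linear {K : S2 → ℝ} (hK : ContDiffOn ℝ 2 (radialExt K) {0}ᶜ) (a : E3)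
    (x : S2) : sphereLaplacian (K + fun x : S2 => ⟪a, (x : E3)⟫) x =
      sphereLaplacian K x - 2 * ⟪a, (x : E3)⟫ := by
  have hx := isOpen_punct.mem_nhds (S2.ne_zero x)
  rw [sub_eq_add_neg, ← sphereLaplacian_linear, sphereLaplacian, radialExt_add,
    (hK.contDiffAt hx).laplacian_add ((contDiffOn_radialExt_linear a 2).contDiffAt hx)]
  rfl

theorem inner_sphereGradient_self {K : S2 → ℝ} (hK : ContDiffOn ℝ 2 (radialExt K) {0}ᶜ)
    (x : S2) : ⟪sphereGradient K x, (x : E3)⟫ = 0 := by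
  rw [real_inner_comm]
  exact inner_gradient_radialExt_self (hK.of_le (by norm_num)) (S2.ne_zero x)

end linear

/-- `C` bounds `K`, its gradient and its Laplacian, and is a Lipschitz constant of the gradient. -/
structure IsC2Bound (K : S2 → ℝ) (C : ℝ) : Prop where
  val : ∀ x, |K x| ≤ C
  grad : ∀ x, ‖sphereGradient K x‖ ≤ C
  lap : ∀ x, |sphereLaplacian K x| ≤ C
  lip : ∀ x y : S2, ‖sphereGradient K x - sphereGradient K y‖ ≤ C * ‖(x : E3) - y‖

theorem exists_isC2Bound {K : S2 → ℝ} (hK : ContDiffOn ℝ 2 (radialExt K) {0}ᶜ) :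
    ∃ C, IsC2Bound K C := by
  have hG : ContDiffOn ℝ 1 (gradient (radialExt K)) {0}ᶜ := contDiffOn_gradient (n := 1) hK
  have hΔ : ContDiffOn ℝ 0 (Laplacian.laplacian (radialExt K)) {0}ᶜ := by
    have h2 : ContDiffOn ℝ 0 (fderiv ℝ (gradient (radialExt K))) {0}ᶜ :=
      hG.fderiv_of_isOpen isOpen_punct (by norm_num)
    refine ContDiffOn.congr (f := divergence (gradient (radialExt K))) ?_
      fun x hx => (divergence_gradient hK hx).symm
    exact ContDiffOn.sum fun i _ => contDiffOn_const.inner ℝ (h2.clm_apply contDiffOn_const)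
  obtain ⟨C₀, -, h₀⟩ := exists_bound (k := 2) hK
  obtain ⟨C₁, -, h₁⟩ := exists_bound (k := 1) (by exact_mod_cast hG)
  obtain ⟨C₂, -, h₂⟩ := exists_bound (k := 0) (by exact_mod_cast hΔ)
  have hloc : LocallyLipschitzOn (Metric.sphere (0 : E3) 1) (gradient (radialExt K)) := by
    intro x hx
    obtain ⟨L, t, ht, hL⟩ := (hG.contDiffAt
      (isOpen_punct.mem_nhds (S2.ne_zero ⟨x, hx⟩))).exists_lipschitzOnWith
    exact ⟨L, t, mem_nhdsWithin_of_mem_nhds ht, hL⟩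
  obtain ⟨L, hL⟩ := hloc.exists_lipschitzOnWith_of_compact (isCompact_sphere _ _)
  refine ⟨max (max C₀ C₁) (max C₂ L), fun x => ?_, fun x => ?_, fun x => ?_, fun x y => ?_⟩
  · have := h₀ x
    rw [radialExt_coe, Real.norm_eq_abs] at this
    exact this.trans (by simp)
  · exact (h₁ x).trans (by simp)
  · exact (h₂ x).trans (by simp)
  · exact (hL.norm_sub_le x.2 y.2).trans (by gcongr; simp)

theorem exists_ne_ne (p q : S2) : ∃ x : S2, x ≠ p ∧ x ≠ q := by
  classical
  let e : Fin 3 → S2 := fun i => ⟨EuclideanSpace.single i 1, by simp⟩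
  have he : Function.Injective e := fun i j hij => by
    have := congrArg (fun y : S2 => (y : E3) i) hij
    by_contra hne
    simp [e, hne] at this
  have hcard : ({p, q} : Finset S2).card < (Finset.univ.image e).card := by
    rw [Finset.card_image_of_injective _ he]
    exact Finset.card_le_two.trans_lt (by simp)
  obtain ⟨x, -, hx⟩ := Finset.exists_mem_notMem_of_card_lt_card hcard
  exact ⟨x, by simpa using hx⟩

/-- If `p` is a critical point of a function on the sphere, with gradient `g` at `x`, then `g` pairs
with `p` like the gradient of the linear function `s ⟨p, ·⟩`, up to an error quadratic in the
distance from `x` to `p`. -/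
theorem le_inner_gradient_pole {C s t : ℝ} {x p d g : E3} (hC : 0 ≤ C) (hx : ‖x‖ = 1)
    (hp : ‖p‖ = 1) (hd : ‖d‖ ≤ C * ‖x - p‖) (hg : g = d + s • p - t • x) (hgx : ⟪g, x⟫ = 0) :
    (1 - ⟪x, p⟫) * (s * (1 + ⟪x, p⟫) - 2 * C) ≤ ⟪g, p⟫ := by
  have hxx : ⟪x, x⟫ = (1 : ℝ) := by rw [real_inner_self_eq_norm_sq, hx, one_pow]
  have hpp : ⟪p, p⟫ = (1 : ℝ) := by rw [real_inner_self_eq_norm_sq, hp, one_pow]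
  have hsq : ‖x - p‖ ^ 2 = 2 * (1 - ⟪x, p⟫) := by
    rw [norm_sub_sq_real, hx, hp]
    ring
  have hP : ‖p - ⟪x, p⟫ • x‖ ^ 2 = 1 - ⟪x, p⟫ ^ 2 := by
    rw [norm_sub_sq_real, norm_smul, hx, hp, inner_smul_right, real_inner_comm, Real.norm_eq_abs,
      mul_one, sq_abs]
    ring
  have hPle : ‖p - ⟪x, p⟫ • x‖ ≤ ‖x - p‖ := by
    refine (sq_le_sq₀ (norm_nonneg _) (norm_nonneg _)).mp ?_
    rw [hP, hsq]
    nlinarith [sq_nonneg (1 - ⟪x, p⟫)]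
  have hdP : -(C * ‖x - p‖ ^ 2) ≤ ⟪d, p - ⟪x, p⟫ • x⟫ := by
    refine (neg_le_neg ?_).trans (neg_le_of_abs_le (abs_real_inner_le_norm _ _))
    calc ‖d‖ * ‖p - ⟪x, p⟫ • x‖ ≤ (C * ‖x - p‖) * ‖x - p‖ := by gcongr
      _ = C * ‖x - p‖ ^ 2 := by ring
  have hgp : ⟪g, p⟫ = ⟪d, p - ⟪x, p⟫ • x⟫ + s * (1 - ⟪x, p⟫ ^ 2) := by
    have h : ⟪g, p⟫ = ⟪g, p - ⟪x, p⟫ • x⟫ := by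
      rw [inner_sub_right, inner_smul_right, hgx, mul_zero, sub_zero]
    rw [h, hg]
    simp only [inner_add_left, inner_sub_left, inner_sub_right, inner_smul_left, inner_smul_right,
      hxx, hpp, real_inner_comm x p, RCLike.conj_to_real]
    ring
  rw [hgp]
  rw [hsq] at hdP
  linarith

/-- The skew map `v ↦ ⟨v, p⟩ q - ⟨v, q⟩ p`. The conformal field
`(p - q) - ⟨p - q, x⟩ x + ⟨x, p⟩ q - ⟨x, q⟩ p` of the sphere flows from its zero `q` to its
zero `p`. -/
def poleRotation (p q : E3) : E3 →L[ℝ] E3 :=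
  (innerSL ℝ p).smulRight q - (innerSL ℝ q).smulRight p

theorem poleRotation_apply (p q v : E3) : poleRotation p q v = ⟪v, p⟫ • q - ⟪v, q⟫ • p := by
  simp [poleRotation, real_inner_comm]

theorem inner_poleRotation_self (p q v : E3) : ⟪poleRotation p q v, v⟫ = 0 := by
  rw [poleRotation_apply, inner_sub_left, inner_smul_left, inner_smul_left, RCLike.conj_to_real,
    RCLike.conj_to_real, real_inner_comm q, real_inner_comm p]
  ring

theorem inner_conformal_field {g x : E3} (hgx : ⟪g, x⟫ = 0) (p q : E3) :
    ⟪g, (p - q) - ⟪p - q, x⟫ • x + poleRotation p q x⟫ =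
      (1 - ⟪x, q⟫) * ⟪g, p⟫ + (1 - ⟪x, p⟫) * ⟪-g, q⟫ := by
  rw [poleRotation_apply]
  simp only [inner_add_right, inner_sub_right, inner_smul_right, hgx, inner_neg_left]
  ring

section perturbation

variable {K : S2 → ℝ} {C : ℝ}

/-- For `|a|` large, `K + ⟨a, ·⟩` increases along the conformal field that flows from its minimum
`q` to its maximum `p`. -/
theorem exists_conformal_field_pos (hK : ContDiffOn ℝ 2 (radialExt K) {0}ᶜ) (hC : IsC2Bound K C)
    {a : E3} (ha : 5 * C < ‖a‖) :
    ∃ p q : S2, ∀ x : S2,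
      let V := ⟪sphereGradient (K + fun x : S2 => ⟪a, (x : E3)⟫) x,
        ((p : E3) - q) - ⟪(p : E3) - q, (x : E3)⟫ • (x : E3) + poleRotation p q x⟫
      0 ≤ V ∧ (x ≠ p → x ≠ q → 0 < V) := by
  set f : S2 → ℝ := K + fun x : S2 => ⟪a, (x : E3)⟫ with hf
  have hf2 : ContDiffOn ℝ 2 (radialExt f) {0}ᶜ := by
    rw [hf, radialExt_add]
    exact hK.add (contDiffOn_radialExt_linear a 2)
  have hfc : Continuous f := by
    have h : f = fun x : S2 => radialExt f x := funext fun x => (radialExt_coe f x).symm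
    rw [h]
    exact hf2.continuousOn.comp_continuous continuous_subtype_val S2.mem
  have hC0 : 0 ≤ C := (abs_nonneg _).trans (hC.val (Classical.arbitrary S2))
  have ha0 : 0 < ‖a‖ := by linarith
  obtain ⟨p, -, hp⟩ := isCompact_univ.exists_isMaxOn Set.univ_nonempty hfc.continuousOn
  obtain ⟨q, -, hq⟩ := isCompact_univ.exists_isMinOn Set.univ_nonempty hfc.continuousOn
  have hp0 : sphereGradient f p = 0 :=
    sphereGradient_eq_zero_of_isLocalMax (hp.isLocalMax Filter.univ_mem)
  have hq0 : sphereGradient f q = 0 :=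
    sphereGradient_eq_zero_of_isLocalMin (hq.isLocalMin Filter.univ_mem)
  have hg : ∀ x, sphereGradient f x = sphereGradient K x + (a - ⟪a, (x : E3)⟫ • (x : E3)) :=
    sphereGradient_add_linear hK a
  rw [hg] at hp0 hq0
  -- `f` oscillates by at least `f (a / |a|) - f (-a / |a|)`
  have hosc : 2 * ‖a‖ - 4 * C ≤ ⟪a, (p : E3)⟫ - ⟪a, (q : E3)⟫ := by
    let b : S2 := toSphere a (norm_pos_iff.mp ha0)
    let b' : S2 := ⟨-b, by simp⟩
    have hb : ⟪a, (b : E3)⟫ = ‖a‖ := by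
      simp only [b, toSphere, inner_smul_right, real_inner_self_eq_norm_sq]
      field_simp
    have hb' : ⟪a, (b' : E3)⟫ = -‖a‖ := by
      simp only [b', inner_neg_right, hb]
    have h1 : f b ≤ f p := hp (Set.mem_univ b)
    have h2 : f q ≤ f b' := hq (Set.mem_univ b')
    simp only [hf, Pi.add_apply, hb, hb'] at h1 h2
    have := abs_le.mp (hC.val p)
    have := abs_le.mp (hC.val q)
    have := abs_le.mp (hC.val b)
    have := abs_le.mp (hC.val b')
    linarith
  refine ⟨p, q, fun x => ?_⟩
  have hgx := inner_sphereGradient_self hf2 x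
  have h1 := le_inner_gradient_pole (g := sphereGradient f x) (s := ⟪a, (p : E3)⟫)
    (t := ⟪a, (x : E3)⟫) hC0 (S2.norm_eq x) (S2.norm_eq p) (hC.lip x p)
    (by rw [hg]; linear_combination (norm := module) hp0) hgx
  have h2 := le_inner_gradient_pole (g := -sphereGradient f x) (s := -⟪a, (q : E3)⟫)
    (d := -(sphereGradient K x - sphereGradient K q))
    (t := -⟪a, (x : E3)⟫) hC0 (S2.norm_eq x) (S2.norm_eq q) (by rw [norm_neg]; exact hC.lip x q)
    (by rw [hg]; linear_combination (norm := module) -hq0) (by rw [inner_neg_left, hgx, neg_zero])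
  -- `⟨a, p⟩ p - ⟨a, q⟩ q = ∇K p - ∇K q`: the critical points `p`, `q` are almost antipodal
  have hpole : -(2 * C) ≤ ⟪a, (p : E3)⟫ * ⟪(x : E3), (p : E3)⟫ -
      ⟪a, (q : E3)⟫ * ⟪(x : E3), (q : E3)⟫ := by
    have e : ⟪a, (p : E3)⟫ * ⟪(x : E3), (p : E3)⟫ - ⟪a, (q : E3)⟫ * ⟪(x : E3), (q : E3)⟫ =
        ⟪(x : E3), sphereGradient K p - sphereGradient K q⟫ := by
      rw [← inner_smul_right, ← inner_smul_right, ← inner_sub_right]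
      congr 1
      linear_combination (norm := module) hq0 - hp0
    rw [e]
    refine (neg_le_neg ?_).trans (neg_le_of_abs_le (abs_real_inner_le_norm _ _))
    rw [S2.norm_eq, one_mul]
    linarith [norm_sub_le (sphereGradient K p) (sphereGradient K q), hC.grad p, hC.grad q]
  have hle : ∀ y : S2, 0 ≤ 1 - ⟪(x : E3), (y : E3)⟫ := fun y => by
    have := real_inner_le_norm (x : E3) (y : E3)
    rw [S2.norm_eq, S2.norm_eq] at this
    linarith
  have hlt : ∀ y : S2, x ≠ y → 0 < 1 - ⟪(x : E3), (y : E3)⟫ := fun y hy => by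
    have := (inner_lt_one_iff_real_of_norm_eq_one (S2.norm_eq x) (S2.norm_eq y)).mpr
      fun h => hy (Subtype.ext h)
    linarith
  have hsum : 0 < ⟪a, (p : E3)⟫ * (1 + ⟪(x : E3), (p : E3)⟫) - 2 * C +
      (-⟪a, (q : E3)⟫ * (1 + ⟪(x : E3), (q : E3)⟫) - 2 * C) := by linarith
  have hV := inner_conformal_field hgx p q
  have h1' := mul_le_mul_of_nonneg_left h1 (hle q)
  have h2' := mul_le_mul_of_nonneg_left h2 (hle p)
  have hmain := mul_nonneg (mul_nonneg (hle p) (hle q)) hsum.le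
  dsimp only
  rw [hV]
  refine ⟨by linarith, fun hxp hxq => ?_⟩
  have hmain' := mul_pos (mul_pos (hlt p hxp) (hlt q hxq)) hsum
  linarith

/-- For `|a|` large, `K + ⟨a, ·⟩` is not the curvature of a metric conformal to the round one. -/
theorem not_curvature_of_lt_norm {u : S2 → ℝ} (hu : ContDiffOn ℝ 2 (radialExt u) {0}ᶜ)
    (hK : ContDiffOn ℝ 2 (radialExt K) {0}ᶜ) (hC : IsC2Bound K C) {a : E3} (ha : 5 * C < ‖a‖) :
    ¬ ∀ x : S2, Real.exp (2 * u x) * (K x + ⟪a, (x : E3)⟫) = 1 - sphereLaplacian u x := by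
  intro heq
  obtain ⟨p, q, hV⟩ := exists_conformal_field_pos hK hC ha
  obtain ⟨x, hxp, hxq⟩ := exists_ne_ne p q
  have hf : ContDiffOn ℝ 1 (radialExt (K + fun x : S2 => ⟪a, (x : E3)⟫)) {0}ᶜ := by
    rw [radialExt_add]
    exact (hK.of_le (by norm_num)).add (contDiffOn_radialExt_linear a 1)
  exact not_exists_inner_conformal_pos hu hf heq _ _ (inner_poleRotation_self p q)
    (fun x => (hV x).1) ⟨x, (hV x).2 hxp hxq⟩

end perturbation

/-! ### The path component of the linear functions -/

theorem IsC2Bound.smul {K : S2 → ℝ} {C : ℝ} (hK : ContDiffOn ℝ 2 (radialExt K) {0}ᶜ)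
    (hC : IsC2Bound K C) {t : ℝ} (ht : t ∈ Set.Icc (0 : ℝ) 1) : IsC2Bound (t • K) C := by
  have hle : ∀ {r s : ℝ}, 0 ≤ r → r ≤ s → |t| * r ≤ s := fun h0 h => by
    rw [abs_of_nonneg ht.1]
    exact (mul_le_of_le_one_left h0 ht.2).trans h
  refine ⟨fun x => ?_, fun x => ?_, fun x => ?_, fun x y => ?_⟩
  · rw [Pi.smul_apply, smul_eq_mul, abs_mul]
    exact hle (abs_nonneg _) (hC.val x)
  · rw [sphereGradient_smul, norm_smul, Real.norm_eq_abs]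
    exact hle (norm_nonneg _) (hC.grad x)
  · have h : sphereLaplacian (t • K) x = t * sphereLaplacian K x := by
      rw [sphereLaplacian, radialExt_const_smul, InnerProductSpace.laplacian_smul _
        (hK.contDiffAt (isOpen_punct.mem_nhds (S2.ne_zero x)))]
      rfl
    rw [h, abs_mul]
    exact hle (abs_nonneg _) (hC.lap x)
  · rw [sphereGradient_smul, sphereGradient_smul, ← smul_sub, norm_smul, Real.norm_eq_abs]
    exact hle (norm_nonneg _) (hC.lip x y)

section membership

variable {k : ℕ} {α : ℝ}

theorem HolderFun.contDiffOn_two (hk : 2 ≤ k) (K : HolderFun k α) :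
    ContDiffOn ℝ 2 (radialExt K) {0}ᶜ :=
  K.reg.1.of_le (by exact_mod_cast hk)

theorem coe_add_linearFun (hα : α ∈ Set.Ioo (0 : ℝ) 1) (K : HolderFun k α) (a : E3) :
    ((K + linearFun hα k a : HolderFun k α) : S2 → ℝ) =
      (K : S2 → ℝ) + fun x : S2 => ⟪a, (x : E3)⟫ := rfl

/-- At a point where `K + ⟨a, ·⟩` violates one of the two conditions its gradient vanishes and
`⟨a, x⟩` is bounded, which bounds `|a|`. -/
theorem add_linearFun_mem_setK (hα : α ∈ Set.Ioo (0 : ℝ) 1) (hk : 2 ≤ k) {K : HolderFun k α}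
    {C : ℝ} (hC : IsC2Bound K C) {a : E3} (ha : 2 * C < ‖a‖) :
    K + linearFun hα k a ∈ setK k α := by
  have hK := K.contDiffOn_two hk
  have hC0 : 0 ≤ C := (abs_nonneg _).trans (hC.val (Classical.arbitrary S2))
  have ha0 : 0 < ‖a‖ := by linarith
  have hpos : K + linearFun hα k a ∈ Cplus k α := by
    refine ⟨toSphere a (norm_pos_iff.mp ha0), ?_⟩
    rw [coe_add_linearFun, Pi.add_apply]
    have h := abs_le.mp (hC.val (toSphere a (norm_pos_iff.mp ha0)))
    have hb : ⟪a, (toSphere a (norm_pos_iff.mp ha0) : E3)⟫ = ‖a‖ := by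
      simp only [toSphere, inner_smul_right, real_inner_self_eq_norm_sq]
      field_simp
    rw [hb]
    linarith
  have key : ∀ x : S2, sphereGradient (K + linearFun hα k a : HolderFun k α) x = 0 →
      C < |⟪a, (x : E3)⟫| := by
    intro x hx
    rw [coe_add_linearFun, sphereGradient_add_linear hK] at hx
    have h1 : ‖a - ⟪a, (x : E3)⟫ • (x : E3)‖ ≤ C := by
      rw [← neg_eq_of_add_eq_zero_right hx, norm_neg]
      exact hC.grad x
    have h2 : ‖a - ⟪a, (x : E3)⟫ • (x : E3)‖ ^ 2 = ‖a‖ ^ 2 - |⟪a, (x : E3)⟫| ^ 2 := by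
      rw [norm_sub_sq_real, norm_smul, S2.norm_eq, inner_smul_right, Real.norm_eq_abs, mul_one,
        sq_abs]
      ring
    by_contra! h3
    have h4 := pow_le_pow_left₀ (norm_nonneg _) h1 2
    have h5 := pow_le_pow_left₀ (abs_nonneg _) h3 2
    nlinarith
  refine ⟨⟨hpos, fun x hx hmax => ?_⟩, ⟨hpos, fun x _ => ?_⟩⟩
  · have h := key x (sphereGradient_eq_zero_of_isLocalMax hmax)
    rw [coe_add_linearFun, Pi.add_apply] at hx
    rw [eq_neg_of_add_eq_zero_right hx, abs_neg] at h
    exact h.not_ge (hC.val x)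
  · by_cases hx : sphereGradient (K + linearFun hα k a : HolderFun k α) x = 0
    · have h := key x hx
      have hΔ : sphereLaplacian (K + linearFun hα k a : HolderFun k α) x ≠ 0 := fun h0 => by
        rw [coe_add_linearFun, sphereLaplacian_add_linear hK, sub_eq_zero] at h0
        have h1 := hC.lap x
        rw [h0, abs_mul, abs_two] at h1
        linarith
      positivity
    · positivity

theorem continuous_linearFun (hα : α ∈ Set.Ioo (0 : ℝ) 1) : Continuous (linearFun hα k) := by
  let L : E3 →ₗ[ℝ] HolderFun k α :=
    { toFun := linearFun hα k
      map_add' := fun a b => HolderFun.ext fun x => inner_add_left a b (x : E3)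
      map_smul' := fun c a => HolderFun.ext fun x => real_inner_smul_left a (x : E3) c }
  exact L.continuous_of_finiteDimensional

theorem linearFun_mem_setK (hα : α ∈ Set.Ioo (0 : ℝ) 1) (hk : 2 ≤ k) {a : E3} (ha : a ≠ 0) :
    linearFun hα k a ∈ setK k α := by
  have h0 : IsC2Bound (0 : HolderFun k α) 0 := by
    have hg : ∀ x, sphereGradient (0 : HolderFun k α) x = 0 := fun x => by
      have h := sphereGradient_smul 0 (0 : S2 → ℝ) x
      rw [zero_smul, zero_smul] at h
      exact h
    refine ⟨fun x => by simp [HolderFun.zero_apply], fun x => by simp [hg], fun x => ?_,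
      fun x y => by simp [hg]⟩
    have h := sphereLaplacian_linear 0 x
    simp only [inner_zero_left, mul_zero, neg_zero] at h
    exact (congrArg abs h).trans abs_zero |>.le
  simpa using add_linearFun_mem_setK hα hk h0 (a := a) (by simpa using ha)

theorem joinedIn_linearFun (hα : α ∈ Set.Ioo (0 : ℝ) 1) (hk : 2 ≤ k) {a b : E3} (ha : a ≠ 0)
    (hb : b ≠ 0) : JoinedIn (setK k α) (linearFun hα k a) (linearFun hα k b) := by
  have h : IsPathConnected ({0}ᶜ : Set E3) :=
    isPathConnected_compl_singleton_of_one_lt_rank (by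
      rw [← Module.finrank_eq_rank]; simp) 0
  refine ((h.joinedIn a ha b hb).map (continuous_linearFun (k := k) hα)).mono ?_
  rintro _ ⟨c, hc, rfl⟩
  exact linearFun_mem_setK hα hk hc

theorem joinedIn_add_linearFun (hα : α ∈ Set.Ioo (0 : ℝ) 1) (hk : 2 ≤ k) {K : HolderFun k α}
    {C : ℝ} (hC : IsC2Bound K C) {a : E3} (ha : 2 * C < ‖a‖) :
    JoinedIn (setK k α) (linearFun hα k a) (K + linearFun hα k a) := by
  refine JoinedIn.ofLine (f := fun t : ℝ => t • K + linearFun hα k a) (by fun_prop) (by simp)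
    (by simp) ?_
  rintro _ ⟨t, ht, rfl⟩
  exact add_linearFun_mem_setK hα hk (hC.smul (K.contDiffOn_two hk) ht) ha

end membership

theorem curvatureMap_eq_iff {m : ℕ} (hm : 4 ≤ m) {α : ℝ} (hα : α ∈ Set.Ioo (0 : ℝ) 1)
    (u : HolderFun m α) (F : HolderFun (m - 2) α) : curvatureMap hm hα u = F ↔
      ∀ x : S2, Real.exp (2 * u x) * F x = 1 - sphereLaplacian u x := by
  have h : ∀ x : S2, curvatureMap hm hα u x =
      Real.exp (-(2 * u x)) * (1 - sphereLaplacian u x) := fun x =>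
    gaussCurvature_eq u x (by exact_mod_cast u.contDiffAt (j := 2) (by omega) x)
  constructor
  · rintro rfl x
    rw [h, ← mul_assoc, ← Real.exp_add, add_neg_cancel, Real.exp_zero, one_mul]
  · intro hF
    refine HolderFun.ext fun x => ?_
    rw [h, ← hF, ← mul_assoc, ← Real.exp_add, neg_add_cancel, Real.exp_zero, one_mul]

end Nirenberg

end

theorem proposition4p4 (m : ℕ) (hm : 4 ≤ m) (α : ℝ) (hα : α ∈ Set.Ioo (0 : ℝ) 1) :
    (∀ K : Nirenberg.HolderFun (m - 2) α,
      Bornology.IsBounded {a : Nirenberg.E3 |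
        K + Nirenberg.linearFun hα (m - 2) a ∈ Set.range (Nirenberg.curvatureMap hm hα)}) ∧
    ∃ K₀ : Set (Nirenberg.HolderFun (m - 2) α), Nirenberg.IsDegreeZeroComponent hm hα K₀ ∧
      ∀ K : Nirenberg.HolderFun (m - 2) α, ∃ R : ℝ, ∀ a : Nirenberg.E3, R < ‖a‖ →
        K + Nirenberg.linearFun hα (m - 2) a ∈ K₀ ∧
        ¬ ∃ u : Nirenberg.HolderFun m α, ∀ x : Nirenberg.S2,
          Real.exp (2 * u x) * (K x + inner ℝ a (x : Nirenberg.E3)) =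
            1 - Nirenberg.sphereLaplacian u x := by
  have hk : 2 ≤ m - 2 := by omega
  have nosol : ∀ (K : Nirenberg.HolderFun (m - 2) α) (C : ℝ), Nirenberg.IsC2Bound K C →
      ∀ a : Nirenberg.E3, 5 * C < ‖a‖ → ¬ ∃ u : Nirenberg.HolderFun m α, ∀ x : Nirenberg.S2,
        Real.exp (2 * u x) * (K x + inner ℝ a (x : Nirenberg.E3)) =
          1 - Nirenberg.sphereLaplacian u x := by
    rintro K C hC a ha ⟨u, hu⟩
    exact Nirenberg.not_curvature_of_lt_norm (u.contDiffOn_two (by omega)) (K.contDiffOn_two hk)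
      hC ha hu
  have norange : ∀ (K : Nirenberg.HolderFun (m - 2) α) (C : ℝ), Nirenberg.IsC2Bound K C →
      ∀ a : Nirenberg.E3, 5 * C < ‖a‖ →
        K + Nirenberg.linearFun hα (m - 2) a ∉ Set.range (Nirenberg.curvatureMap hm hα) := by
    rintro K C hC a ha ⟨u, hu⟩
    exact nosol K C hC a ha ⟨u, (Nirenberg.curvatureMap_eq_iff hm hα u _).mp hu⟩
  refine ⟨fun K => ?_, ?_⟩
  · obtain ⟨C, hC⟩ := Nirenberg.exists_isC2Bound (K.contDiffOn_two hk)
    refine isBounded_iff_forall_norm_le.mpr ⟨5 * C, fun a ha => ?_⟩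
    by_contra! h
    exact norange K C hC a h ha
  · let e : Nirenberg.E3 := EuclideanSpace.single 0 1
    have he : e ≠ 0 := by simp [e]
    have hmem : ∀ (K : Nirenberg.HolderFun (m - 2) α) (C : ℝ), Nirenberg.IsC2Bound K C →
        ∀ a : Nirenberg.E3, 5 * C < ‖a‖ → K + Nirenberg.linearFun hα (m - 2) a ∈
          pathComponentIn (Nirenberg.setK (m - 2) α) (Nirenberg.linearFun hα (m - 2) e) := by
      intro K C hC a ha
      have hC0 : 0 ≤ C := (abs_nonneg _).trans (hC.val (Classical.arbitrary Nirenberg.S2))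
      have ha0 : a ≠ 0 := norm_pos_iff.mp (by linarith)
      exact (Nirenberg.joinedIn_linearFun hα hk he ha0).trans
        (Nirenberg.joinedIn_add_linearFun hα hk hC (by linarith))
    refine ⟨pathComponentIn (Nirenberg.setK (m - 2) α) (Nirenberg.linearFun hα (m - 2) e),
      ⟨⟨_, Nirenberg.linearFun_mem_setK hα hk he, rfl⟩, fun o => ?_⟩, fun K => ?_⟩
    · obtain ⟨C, hC⟩ := Nirenberg.exists_isC2Bound
        ((0 : Nirenberg.HolderFun (m - 2) α).contDiffOn_two hk)
      obtain ⟨a, ha⟩ := NormedSpace.exists_lt_norm ℝ Nirenberg.E3 (5 * C)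
      have hfib := norange 0 C hC a ha
      have hempty : Nirenberg.curvatureMap hm hα ⁻¹'
          {0 + Nirenberg.linearFun hα (m - 2) a} = ∅ :=
        Set.preimage_singleton_eq_empty.mpr hfib
      exact ⟨_, hmem 0 C hC a ha, fun u hu => (hfib ⟨u, hu⟩).elim, by rw [hempty]; simp,
        by rw [hempty]; simp⟩
    · obtain ⟨C, hC⟩ := Nirenberg.exists_isC2Bound (K.contDiffOn_two hk)
      exact ⟨5 * C, fun a ha => ⟨hmem K C hC a ha, nosol K C hC a ha⟩⟩
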